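/- Let $g\in C^2(\mathbb R)$ be bounded and strictly increasing, with $g(0)=0$, strictly concave on $(0,+\infty)$ and strictly convex on $(-\infty,0)$; put $g_\pm=\lim_{s\to\pm\infty}g(s)$ and $G(s)=\int_0^s g$. A function $q\in L^\infty(\mathbb R)$ is said to have asymptotic average $A(q)$ if $\frac1T\int_t^{t+T}q(s)\,ds\to A(q)$ as $T\to+\infty$, uniformly in $t\in\mathbb R$. Let $p$ be bounded and continuous on $\mathbb R$ with asymptotic average $A(p)\in(g_-,g_+)$. For $q\in L^\infty(\mathbb R)$ and $\varepsilon>0$, an $\varepsilon$-decomposition of $q$ is an identity $q=q_1+\dot q_2$ (weak derivative) with $\|q_1-A(p)\|_\infty<\varepsilon/2$ and $q_2\in L^\infty(\mathbb R)$. Such a decomposition of $p$ exists for each $\varepsilon>0$; fix for every $\varepsilon\in(0,1)$ any one of them, $p=p_{1,\varepsilon}+\dot p_{2,\varepsilon}$, and let $\mathcal P$ be the set of all $q\in L^\infty(\mathbb R)$ such that $\|q\|_\infty<\|p\|_\infty+1$, $q$ has asymptotic average $A(q)=A(p)$, and for every $\varepsilon\in(0,1)$ there is an $\varepsilon$-decomposition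 $q=q_{1,\varepsilon}+\dot q_{2,\varepsilon}$ with $\|q_{2,\varepsilon}\|_\infty<\|p_{2,\varepsilon}\|_\infty+1$. For $a<b$ let $H^1_0(a,b)^+=\{u\in H^1_0(a,b):u\ge 0\}$ and $$J_{(a,b),q}(u)=\int_a^b\Big[\tfrac12\dot u(t)^2-G(u(t))+q(t)u(t)\Big]\,dt .$$ (i) There is $\tilde L>0$, which may be taken larger than any prescribed number and which does not depend on $a$, $b$, $q$, such that whenever $b-a\ge\tilde L$ and $q\in\mathcal P$, the functional $J_{(a,b),q}$ has exactly one minimizer $u$ in $H^1_0(a,b)^+$; moreover $u>0$ in $(a,b)$, and $u$ solves $$\ddot u(t)+g(u(t))=q(t)\ \text{ in }(a,b),\qquad u(a)=0=u(b),$$ in the sense that $u\in C^1([a,b])$, $\dot u$ is absolutely continuous on $[a,b]$ and the equation holds almost everywhere; if $q$ is continuous in $(a,b)$, then $u\in C^2(a,b)$ and the equation holds at every point of $(a,b)$. (ii) For every bounded interval $(a,b)$, $a<b$, any two minimizers $u,v$ of $J_{(a,b),p}$ in $H^1_0(a,b)^+$ that belong to $C^2(a,b)$ and are strictly positive in $(a,b)$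 coincide on $[a,b]$. -/

import Mathlib

open Set Filter Topology MeasureTheory

noncomputable section

namespace BVP

/-- Standing assumptions on the nonlinearity `g`. -/
structure AdmissibleNonlinearity (g : ℝ → ℝ) : Prop where
  zero : g 0 = 0
  contDiff : ContDiff ℝ 2 g
  bounded : ∃ C : ℝ, ∀ s, |g s| ≤ C
  strictMono : StrictMono g
  strictConcave : StrictConcaveOn ℝ (Ioi 0) g
  strictConvex : StrictConvexOn ℝ (Iio 0) g

/-- `p` has asymptotic average `A`: the means of `p` over `(t, t + T)` converge to `A` as
`T → +∞`, uniformly in `t`. -/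
def HasAsymptoticAverage (p : ℝ → ℝ) (A : ℝ) : Prop :=
  ∀ ε > 0, ∃ T₀ > 0, ∀ T > T₀, ∀ t : ℝ, |(1 / T) * (∫ s in t..(t + T), p s) - A| < ε

/-- Standing assumptions on the forcing term `p`: bounded and continuous, with an asymptotic
average `A` strictly between the limits `gm`, `gp` of the nonlinearity. -/
structure AdmissibleForcing (gm gp : ℝ) (p : ℝ → ℝ) (A : ℝ) : Prop where
  continuous : Continuous p
  bounded : ∃ C : ℝ, ∀ t, |p t| ≤ C
  average : HasAsymptoticAverage p A
  lower : gm < A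
  upper : A < gp

/-- A decomposition `q = q₁ + q₂'` at level `ε` with respect to `A`:
`‖q₁ - A‖_∞ < ε / 2`, `q₂ ∈ L^∞(ℝ)`, and `q₂` is a primitive of `q - q₁`. (For `q ∈ L^∞(ℝ)` the
weak derivative `q₂' = q - q₁` is bounded; `q₂` is its Lipschitz continuous representative.) -/
structure IsDecomposition (q : ℝ → ℝ) (A ε : ℝ) (q₁ q₂ : ℝ → ℝ) : Prop where
  measurable_fst : AEStronglyMeasurable q₁ volume
  norm_fst : eLpNorm (fun t => q₁ t - A) ⊤ volume < ENNReal.ofReal (ε / 2)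
  memLp_snd : MemLp q₂ ⊤ volume
  primitive : ∀ s t : ℝ, q₂ t - q₂ s = ∫ x in s..t, (q x - q₁ x)

/-- The class `𝒫` attached to `p`, to its asymptotic average `A` and to the family
`(p₂ ε)`, `0 < ε < 1`, of bounded primitives in the decompositions chosen for `p`:
all `q ∈ L^∞(ℝ)` with `‖q‖_∞ < ‖p‖_∞ + 1`, with asymptotic average `A`, and such that for each
`ε ∈ (0, 1)` there is a decomposition `q = q₁ + q₂'` with `‖q₂‖_∞ < ‖p₂ ε‖_∞ + 1`. -/
def classP (p : ℝ → ℝ) (A : ℝ) (p₂ : ℝ → ℝ → ℝ) : Set (ℝ → ℝ) :=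
  {q | MemLp q ⊤ volume ∧
    eLpNorm q ⊤ volume < eLpNorm p ⊤ volume + 1 ∧
    HasAsymptoticAverage q A ∧
    ∀ ε ∈ Ioo (0 : ℝ) 1, ∃ q₁ q₂ : ℝ → ℝ, IsDecomposition q A ε q₁ q₂ ∧
      eLpNorm q₂ ⊤ volume < eLpNorm (p₂ ε) ⊤ volume + 1}

/-- The space `H¹₀(a, b)` on a bounded interval: absolutely continuous functions on `[a, b]` with
square integrable derivative that vanish at `a` and `b`. Only the values on `[a, b]` matter. -/
def H10 (a b : ℝ) : Set (ℝ → ℝ) :=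
  {u | AbsolutelyContinuousOnInterval u a b ∧
    MemLp (deriv u) 2 (volume.restrict (Ioo a b)) ∧ u a = 0 ∧ u b = 0}

/-- The nonnegative functions in `H¹₀(a, b)`. -/
def H10plus (a b : ℝ) : Set (ℝ → ℝ) :=
  {u | u ∈ H10 a b ∧ ∀ t ∈ Icc a b, 0 ≤ u t}

/-- The primitive of `g` vanishing at `0`. -/
def primitiveG (g : ℝ → ℝ) (s : ℝ) : ℝ := ∫ x in (0 : ℝ)..s, g x

/-- The action functional `J_{(a,b),q}(u) = ∫_a^b (u'² / 2 - G(u) + q u)`. -/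
def action (g q : ℝ → ℝ) (a b : ℝ) (u : ℝ → ℝ) : ℝ :=
  ∫ t in a..b, ((1 / 2) * deriv u t ^ 2 - primitiveG g (u t) + q t * u t)

/-- `u` minimizes the action over the nonnegative functions in `H¹₀(a, b)`. -/
def IsMinimizer (g q : ℝ → ℝ) (a b : ℝ) (u : ℝ → ℝ) : Prop :=
  u ∈ H10plus a b ∧ IsMinOn (action g q a b) (H10plus a b) u

/-- `u` solves `u'' + g(u) = q` in `(a, b)`, `u(a) = 0 = u(b)`, `u > 0` in `(a, b)`, for
`q ∈ L^∞`: `u` is `C¹` on `[a, b]`, its derivative `w` is absolutely continuous on `[a, b]`, and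
the equation holds almost everywhere. -/
def SolvesDirichlet (g q : ℝ → ℝ) (a b : ℝ) (u : ℝ → ℝ) : Prop :=
  (∃ w : ℝ → ℝ, AbsolutelyContinuousOnInterval w a b ∧
      (∀ t ∈ Icc a b, HasDerivWithinAt u (w t) (Icc a b) t) ∧
      ∀ᵐ t ∂(volume.restrict (Ioo a b)), HasDerivAt w (q t - g (u t)) t) ∧
    u a = 0 ∧ u b = 0 ∧ ∀ t ∈ Ioo a b, 0 < u t

/-- `u` is a classical solution of the same problem: `u ∈ C²(a, b) ∩ C[a, b]` and the equation
holds at each point of `(a, b)`. -/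
def SolvesDirichletClassically (g q : ℝ → ℝ) (a b : ℝ) (u : ℝ → ℝ) : Prop :=
  ContDiffOn ℝ 2 u (Ioo a b) ∧ ContinuousOn u (Icc a b) ∧
    (∀ t ∈ Ioo a b, deriv (deriv u) t + g (u t) = q t) ∧
    u a = 0 ∧ u b = 0 ∧ ∀ t ∈ Ioo a b, 0 < u t

/-- Decompositions of a bounded continuous `p` with asymptotic average exist at each level, so the
families used to form the class `𝒫` exist. -/
theorem exists_decomposition {p : ℝ → ℝ} {A : ℝ} (hc : Continuous p)
    (hb : ∃ C : ℝ, ∀ t, |p t| ≤ C) (ha : HasAsymptoticAverage p A) {ε : ℝ} (hε : 0 < ε) :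
    ∃ p₁ p₂ : ℝ → ℝ, IsDecomposition p A ε p₁ p₂ := by
  obtain ⟨C, hC⟩ := hb
  obtain ⟨T₀, hT₀, hT⟩ := ha (ε / 4) (by positivity)
  set T := T₀ + 1 with hTdef
  have hTpos : 0 < T := by positivity
  set P : ℝ → ℝ := fun t => ∫ s in (0 : ℝ)..t, p s with hP
  have hPd : ∀ t, HasDerivAt P (p t) t := fun t => hc.integral_hasStrictDerivAt 0 t |>.hasDerivAt
  have hPc : Continuous P := continuous_iff_continuousAt.2 fun t => (hPd t).continuousAt
  set Q : ℝ → ℝ := fun t => ∫ s in (0 : ℝ)..t, P s with hQ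
  have hQd : ∀ t, HasDerivAt Q (P t) t := fun t => hPc.integral_hasStrictDerivAt 0 t |>.hasDerivAt
  have hQc : Continuous Q := continuous_iff_continuousAt.2 fun t => (hQd t).continuousAt
  have hPsub : ∀ s t, P t - P s = ∫ x in s..t, p x := fun s t =>
    (intervalIntegral.integral_eq_sub_of_hasDerivAt (fun x _ => hPd x)
      (hc.intervalIntegrable _ _)).symm
  have hQsub : ∀ s t, Q t - Q s = ∫ x in s..t, P x := fun s t =>
    (intervalIntegral.integral_eq_sub_of_hasDerivAt (fun x _ => hQd x)
      (hPc.intervalIntegrable _ _)).symm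
  set p₁ : ℝ → ℝ := fun t => (1 / T) * (P (t + T) - P t) with hp₁
  set p₂ : ℝ → ℝ := fun t => P t - (1 / T) * (Q (t + T) - Q t) with hp₂
  have hp₁c : Continuous p₁ := by fun_prop
  have hp₂c : Continuous p₂ := by fun_prop
  refine ⟨p₁, p₂, hp₁c.aestronglyMeasurable, ?_, ?_, ?_⟩
  · refine lt_of_le_of_lt (b := ENNReal.ofReal (ε / 4)) ?_
      ((ENNReal.ofReal_lt_ofReal_iff (by positivity)).2 (by linarith))
    rw [eLpNorm_exponent_top]
    refine eLpNormEssSup_le_of_ae_bound (Eventually.of_forall fun t => ?_)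
    rw [Real.norm_eq_abs, hp₁]
    simp only [hPsub]
    exact (hT T (by linarith) t).le
  · refine memLp_top_of_bound hp₂c.aestronglyMeasurable (C * T) (Eventually.of_forall fun t => ?_)
    have hC0 : 0 ≤ C := (abs_nonneg _).trans (hC 0)
    have hb : ∀ s t, |P t - P s| ≤ C * |t - s| := fun s t => by
      rw [hPsub, ← Real.norm_eq_abs]
      exact intervalIntegral.norm_integral_le_of_norm_le_const fun x _ => hC x
    have h1 : p₂ t = (1 / T) * ∫ x in t..(t + T), (P t - P x) := by
      rw [intervalIntegral.integral_sub (by simp) (hPc.intervalIntegrable _ _), ← hQsub]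
      simp only [hp₂, intervalIntegral.integral_const, smul_eq_mul]
      field_simp
      ring
    have h2 : |∫ x in t..(t + T), (P t - P x)| ≤ (C * T) * |t + T - t| := by
      rw [← Real.norm_eq_abs]
      refine intervalIntegral.norm_integral_le_of_norm_le_const fun x hx => ?_
      rw [uIoc_of_le (by linarith)] at hx
      refine (hb x t).trans (mul_le_mul_of_nonneg_left ?_ hC0)
      rw [abs_le]
      constructor <;> linarith [hx.1, hx.2]
    rw [add_sub_cancel_left, abs_of_pos hTpos] at h2
    rw [h1, Real.norm_eq_abs, abs_mul, abs_of_pos (by positivity : 0 < 1 / T)]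
    calc 1 / T * |∫ x in t..(t + T), (P t - P x)| ≤ 1 / T * (C * T * T) :=
          mul_le_mul_of_nonneg_left h2 (by positivity)
      _ = C * T := by field_simp
  · intro s t
    refine (intervalIntegral.integral_eq_sub_of_hasDerivAt (f := p₂) (fun x _ => ?_)
      ((hc.sub hp₁c).intervalIntegrable _ _)).symm
    have h := (hPd x).sub ((((hQd (x + T)).comp_add_const x T).sub (hQd x)).const_mul (1 / T))
    exact h

end BVP

end

/-! Uniqueness rests on the strict concavity of g on the positive axis. The actions of max(u, v) and
min(u, v) add up to those of u and v, so the maximum of two minimizers is again one, and it suffices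
to compare ordered positive minimizers u ≤ m. Both satisfy the weak equation. Testing with m - u and
using that the actions are equal leaves ∫ [G(m) - G(u) - (g(u) + g(m))(m - u)/2] = 0. The integrand
is the error of the trapezoidal rule, positive wherever 0 < u < m (`trapezoid_lt_primitiveG_sub`),
so u = m (`IsMinimizer.eqOn_of_le`, `IsMinimizer.eqOn`). The length of the interval plays no role
here.

Long intervals serve to exclude interior zeros (`IsMinimizer.pos_of_long`). A minimizer over the
nonnegative cone satisfies a variational inequality, which says that u minus a second primitive of q
- g(u) is concave (`IsMinimizer.slope_le`). At an interior zero this limits how steeply u can rise.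
Where u ≥ R, with g(R) ≥ A + ε, the force q - g(u) is negative on average, so u stays below a
constant M on either side of the zero (`le_of_zero_left`, `le_of_zero_right`). But on a long
interval a function below M is not optimal: adding a tent of large fixed height lowers the action by
an amount proportional to the length, at a bounded cost (`IsMinimizer.not_bounded_of_long`). The
constants depend only on g and on bounds for q and for q₂ at a single ε, hence the uniformity in 𝒫.

Existence is the direct method with the derivative as variable in L² (`exists_isMinOn_of_compact`).
Regularity follows because a positive minimizer admits variations of both signs, so that the concave
function above is affine (`IsMinimizer.exists_eq_affine_add`). -/

noncomputable section

namespace BVP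

/-! ### Absolutely continuous functions and the lattice structure of H¹₀. -/

section AbsolutelyContinuous

variable {f g : ℝ → ℝ} {a b : ℝ}

protected lemma _root_.AbsolutelyContinuousOnInterval.abs (hf : AbsolutelyContinuousOnInterval f a b) :
    AbsolutelyContinuousOnInterval (fun t => |f t|) a b := by
  refine squeeze_zero (fun E => Finset.sum_nonneg fun i _ => dist_nonneg) (fun E => ?_) hf
  exact Finset.sum_le_sum fun i _ => by
    simpa only [Real.dist_eq] using abs_abs_sub_abs_le_abs_sub _ _

protected lemma _root_.AbsolutelyContinuousOnInterval.max (hf : AbsolutelyContinuousOnInterval f a b)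
    (hg : AbsolutelyContinuousOnInterval g a b) :
    AbsolutelyContinuousOnInterval (fun t => max (f t) (g t)) a b := by
  have h := ((hf.add hg).add (hf.sub hg).abs).const_mul (1 / 2)
  have e : (fun t => max (f t) (g t)) = fun t => 1 / 2 * ((f + g) + fun t => |(f - g) t|) t := by
    funext t
    simp only [Pi.add_apply, Pi.sub_apply]
    rcases le_total (f t) (g t) with h | h
    · rw [max_eq_right h, abs_of_nonpos (sub_nonpos.2 h)]
      ring
    · rw [max_eq_left h, abs_of_nonneg (sub_nonneg.2 h)]
      ring
  rw [e]
  exact h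

protected lemma _root_.AbsolutelyContinuousOnInterval.min (hf : AbsolutelyContinuousOnInterval f a b)
    (hg : AbsolutelyContinuousOnInterval g a b) :
    AbsolutelyContinuousOnInterval (fun t => min (f t) (g t)) a b := by
  have h := (hf.neg.max hg.neg).neg
  have e : (fun t => min (f t) (g t)) = -fun t => max ((-f) t) ((-g) t) := by
    funext t
    simp [max_neg_neg]
  rw [e]
  exact h

lemma ae_differentiableAt_Icc (hf : AbsolutelyContinuousOnInterval f a b) (hab : a ≤ b) :
    ∀ᵐ t, t ∈ Icc a b → DifferentiableAt ℝ f t := by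
  simpa only [uIcc_of_le hab] using hf.ae_differentiableAt

lemma ae_mem_Ioo_of_mem_Icc (a b : ℝ) : ∀ᵐ t : ℝ, t ∈ Icc a b → t ∈ Ioo a b := by
  have ha : ∀ᵐ t : ℝ, t ≠ a := by simp [ae_iff, measure_singleton]
  have hb : ∀ᵐ t : ℝ, t ≠ b := by simp [ae_iff, measure_singleton]
  filter_upwards [ha, hb] with t h1 h2 h
  exact ⟨lt_of_le_of_ne h.1 h1.symm, lt_of_le_of_ne h.2 h2⟩

lemma integral_congr_ae_Icc {F H : ℝ → ℝ} (hab : a ≤ b)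
    (h : ∀ᵐ t, t ∈ Icc a b → F t = H t) : ∫ t in a..b, F t = ∫ t in a..b, H t := by
  refine intervalIntegral.integral_congr_ae ?_
  filter_upwards [h] with t ht htm
  rw [uIoc_of_le hab] at htm
  exact ht (Ioc_subset_Icc_self htm)

lemma integral_mono_ae_Icc {F H : ℝ → ℝ} (hab : a ≤ b) (hF : IntervalIntegrable F volume a b)
    (hH : IntervalIntegrable H volume a b)
    (h : ∀ᵐ t, t ∈ Icc a b → F t ≤ H t) : ∫ t in a..b, F t ≤ ∫ t in a..b, H t := by
  refine intervalIntegral.integral_mono_ae_restrict hab hF hH ?_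
  exact (ae_restrict_iff' measurableSet_Icc).2 h

end AbsolutelyContinuous

section H10

variable {u v : ℝ → ℝ} {a b : ℝ}

lemma H10.continuousOn (hu : u ∈ H10 a b) (hab : a ≤ b) : ContinuousOn u (Icc a b) := by
  simpa only [uIcc_of_le hab] using hu.1.continuousOn

lemma H10.memLp_deriv (hu : u ∈ H10 a b) : MemLp (deriv u) 2 (volume.restrict (Ioc a b)) := by
  rw [← restrict_Ioo_eq_restrict_Ioc]
  exact hu.2.1

lemma intervalIntegrable_mul_of_memLp {f h : ℝ → ℝ} (hab : a ≤ b)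
    (hf : MemLp f 2 (volume.restrict (Ioc a b))) (hh : MemLp h 2 (volume.restrict (Ioc a b))) :
    IntervalIntegrable (fun t => f t * h t) volume a b := by
  rw [intervalIntegrable_iff_integrableOn_Ioc_of_le hab]
  exact hf.integrable_mul hh

lemma H10.intervalIntegrable_deriv_mul (hab : a ≤ b) (hu : u ∈ H10 a b) (hv : v ∈ H10 a b) :
    IntervalIntegrable (fun t => deriv u t * deriv v t) volume a b :=
  intervalIntegrable_mul_of_memLp hab (H10.memLp_deriv hu) (H10.memLp_deriv hv)

lemma H10.intervalIntegrable_deriv_sq (hab : a ≤ b) (hu : u ∈ H10 a b) :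
    IntervalIntegrable (fun t => deriv u t ^ 2) volume a b := by
  simpa only [sq] using H10.intervalIntegrable_deriv_mul hab hu hu

lemma ae_deriv_add (hab : a ≤ b) (hu : AbsolutelyContinuousOnInterval u a b)
    (hv : AbsolutelyContinuousOnInterval v a b) :
    ∀ᵐ t, t ∈ Icc a b → deriv (fun s => u s + v s) t = deriv u t + deriv v t := by
  filter_upwards [ae_differentiableAt_Icc hu hab, ae_differentiableAt_Icc hv hab] with t h1 h2 h
  exact deriv_fun_add (h1 h) (h2 h)

lemma ae_deriv_sub (hab : a ≤ b) (hu : AbsolutelyContinuousOnInterval u a b)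
    (hv : AbsolutelyContinuousOnInterval v a b) :
    ∀ᵐ t, t ∈ Icc a b → deriv (fun s => u s - v s) t = deriv u t - deriv v t := by
  filter_upwards [ae_differentiableAt_Icc hu hab, ae_differentiableAt_Icc hv hab] with t h1 h2 h
  exact deriv_fun_sub (h1 h) (h2 h)

lemma ae_restrict_Ioo_of_ae_Icc {P : ℝ → Prop} (h : ∀ᵐ t, t ∈ Icc a b → P t) :
    ∀ᵐ t ∂(volume.restrict (Ioo a b)), P t := by
  rw [ae_restrict_iff' measurableSet_Ioo]
  filter_upwards [h] with t ht hm
  exact ht (Ioo_subset_Icc_self hm)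

lemma H10.add (hab : a ≤ b) (hu : u ∈ H10 a b) (hv : v ∈ H10 a b) :
    (fun t => u t + v t) ∈ H10 a b := by
  refine ⟨hu.1.add hv.1, ?_, by simp [hu.2.2.1, hv.2.2.1], by simp [hu.2.2.2, hv.2.2.2]⟩
  refine (hu.2.1.add hv.2.1).ae_eq ?_
  filter_upwards [ae_restrict_Ioo_of_ae_Icc (ae_deriv_add hab hu.1 hv.1)] with t ht
  exact ht.symm

lemma H10.const_mul (hu : u ∈ H10 a b) (c : ℝ) : (fun t => c * u t) ∈ H10 a b := by
  refine ⟨hu.1.const_mul c, ?_, by simp [hu.2.2.1], by simp [hu.2.2.2]⟩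
  have e : deriv (fun t => c * u t) = fun t => c * deriv u t := by
    funext t
    exact deriv_const_mul_field c
  rw [e]
  exact hu.2.1.const_mul c

lemma H10.sub (hab : a ≤ b) (hu : u ∈ H10 a b) (hv : v ∈ H10 a b) :
    (fun t => u t - v t) ∈ H10 a b := by
  simpa [sub_eq_add_neg] using H10.add hab hu (H10.const_mul hv (-1))

lemma mem_H10_of_lipschitzWith {K : NNReal} (hu : LipschitzWith K u) (ha : u a = 0)
    (hb : u b = 0) : u ∈ H10 a b := by
  refine ⟨(hu.lipschitzOnWith).absolutelyContinuousOnInterval, ?_, ha, hb⟩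
  refine MemLp.of_bound (measurable_deriv u).aestronglyMeasurable K (Eventually.of_forall fun t => ?_)
  exact norm_deriv_le_of_lipschitz hu

/-- The derivatives of `u`, `v`, `max u v`, `min u v` almost everywhere. -/
lemma ae_deriv_max_min (hab : a ≤ b) (hu : AbsolutelyContinuousOnInterval u a b)
    (hv : AbsolutelyContinuousOnInterval v a b) :
    ∀ᵐ t, t ∈ Icc a b →
      (v t ≤ u t ∧ deriv (fun s => max (u s) (v s)) t = deriv u t ∧
        deriv (fun s => min (u s) (v s)) t = deriv v t) ∨
      (u t ≤ v t ∧ deriv (fun s => max (u s) (v s)) t = deriv v t ∧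
        deriv (fun s => min (u s) (v s)) t = deriv u t) := by
  filter_upwards [ae_differentiableAt_Icc hu hab, ae_differentiableAt_Icc hv hab,
    ae_differentiableAt_Icc (hu.max hv) hab, ae_differentiableAt_Icc (hu.min hv) hab,
    ae_mem_Ioo_of_mem_Icc a b] with t h1 h2 h3 h4 h5 h
  have hio := Ioo_mem_nhds (h5 h).1 (h5 h).2
  have cu : ContinuousAt u t := (h1 h).continuousAt
  have cv : ContinuousAt v t := (h2 h).continuousAt
  rcases lt_trichotomy (u t) (v t) with hlt | heq | hlt
  · right
    have e := cu.eventually_lt cv hlt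
    refine ⟨hlt.le, Filter.EventuallyEq.deriv_eq ?_, Filter.EventuallyEq.deriv_eq ?_⟩
    · filter_upwards [e] with s hs using max_eq_right hs.le
    · filter_upwards [e] with s hs using min_eq_left hs.le
  · left
    -- At a contact point the larger function minus the smaller one has a minimum, so the two
    -- derivatives agree.
    have key : ∀ f k : ℝ → ℝ, DifferentiableAt ℝ f t → DifferentiableAt ℝ k t →
        (∀ s, k s ≤ f s) → f t = k t → deriv f t = deriv k t := by
      intro f k hf hk hle he
      have hmin : IsLocalMin (fun s => f s - k s) t :=
        Eventually.of_forall fun s => by simp only [he, sub_self]; linarith [hle s]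
      have := hmin.deriv_eq_zero
      rw [deriv_fun_sub hf hk] at this
      linarith
    refine ⟨heq.ge, key _ _ (h3 h) (h1 h) (fun s => le_max_left _ _) (by simp [heq]), ?_⟩
    exact (key _ _ (h2 h) (h4 h) (fun s => min_le_right _ _) (by simp [heq]))|>.symm
  · left
    have e := cv.eventually_lt cu hlt
    refine ⟨hlt.le, Filter.EventuallyEq.deriv_eq ?_, Filter.EventuallyEq.deriv_eq ?_⟩
    · filter_upwards [e] with s hs using max_eq_left hs.le
    · filter_upwards [e] with s hs using min_eq_right hs.le

lemma H10.max_mem (hab : a ≤ b) (hu : u ∈ H10 a b) (hv : v ∈ H10 a b) :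
    (fun t => max (u t) (v t)) ∈ H10 a b := by
  refine ⟨hu.1.max hv.1, ?_, by simp [hu.2.2.1, hv.2.2.1], by simp [hu.2.2.2, hv.2.2.2]⟩
  refine (hu.2.1.norm.add hv.2.1.norm).mono (measurable_deriv _).aestronglyMeasurable ?_
  filter_upwards [ae_restrict_Ioo_of_ae_Icc (ae_deriv_max_min hab hu.1 hv.1)] with t ht
  have h1 := norm_nonneg (deriv u t)
  have h2 := norm_nonneg (deriv v t)
  rw [Pi.add_apply, Real.norm_of_nonneg (add_nonneg h1 h2)]
  rcases ht with ⟨-, e, -⟩ | ⟨-, e, -⟩ <;> rw [e] <;> linarith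

lemma H10.min_mem (hab : a ≤ b) (hu : u ∈ H10 a b) (hv : v ∈ H10 a b) :
    (fun t => min (u t) (v t)) ∈ H10 a b := by
  refine ⟨hu.1.min hv.1, ?_, by simp [hu.2.2.1, hv.2.2.1], by simp [hu.2.2.2, hv.2.2.2]⟩
  refine (hu.2.1.norm.add hv.2.1.norm).mono (measurable_deriv _).aestronglyMeasurable ?_
  filter_upwards [ae_restrict_Ioo_of_ae_Icc (ae_deriv_max_min hab hu.1 hv.1)] with t ht
  have h1 := norm_nonneg (deriv u t)
  have h2 := norm_nonneg (deriv v t)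
  rw [Pi.add_apply, Real.norm_of_nonneg (add_nonneg h1 h2)]
  rcases ht with ⟨-, -, e⟩ | ⟨-, -, e⟩ <;> rw [e] <;> linarith

/-- Integration by parts of a primitive against a function in `H¹₀`. -/
lemma H10.integral_mul_eq_neg {h Q ξ : ℝ → ℝ} (hab : a ≤ b) (hξ : ξ ∈ H10 a b)
    (hh : IntervalIntegrable h volume a b)
    (hQ : ∀ t ∈ Icc a b, Q t = Q a + ∫ s in a..t, h s) :
    ∫ t in a..b, h t * ξ t = -∫ t in a..b, Q t * deriv ξ t := by
  set Q' : ℝ → ℝ := fun t => Q a + ∫ s in a..t, h s with hQ'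
  have hac : AbsolutelyContinuousOnInterval Q' a b :=
    ((LipschitzWith.const (Q a)).lipschitzOnWith (s := uIcc a b)).absolutelyContinuousOnInterval.add
      (hh.absolutelyContinuousOnInterval_intervalIntegral (c := a) (by simp))
  have h1 := hac.integral_mul_deriv_eq_deriv_mul hξ.1
  rw [hξ.2.2.1, hξ.2.2.2] at h1
  have h2 : ∫ t in a..b, Q t * deriv ξ t = ∫ t in a..b, Q' t * deriv ξ t :=
    intervalIntegral.integral_congr fun t ht => by
      rw [uIcc_of_le hab] at ht
      simp only [hQ t ht, hQ']
  have h3 : ∫ t in a..b, deriv Q' t * ξ t = ∫ t in a..b, h t * ξ t := by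
    refine integral_congr_ae_Icc hab ?_
    filter_upwards [hh.ae_hasDerivAt_integral] with t ht hm
    rw [uIcc_of_le hab] at ht
    rw [((ht hm a (left_mem_Icc.2 hab)).const_add (Q a)).deriv]
  rw [h2, h1, h3]
  ring

end H10

section Primitive

variable {g : ℝ → ℝ}

lemma hasDerivAt_primitiveG (hg : Continuous g) (s : ℝ) : HasDerivAt (primitiveG g) (g s) s :=
  (hg.integral_hasStrictDerivAt 0 s).hasDerivAt

lemma continuous_primitiveG (hg : Continuous g) : Continuous (primitiveG g) :=
  continuous_iff_continuousAt.2 fun s => (hasDerivAt_primitiveG hg s).continuousAt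

lemma primitiveG_sub (hg : Continuous g) (x y : ℝ) :
    primitiveG g y - primitiveG g x = ∫ s in x..y, g s :=
  intervalIntegral.integral_interval_sub_left (hg.intervalIntegrable _ _)
    (hg.intervalIntegrable _ _)

/-- Tangent-line inequality for the convex function G. It replaces differentiation of the action
under the integral: it bounds increments of the action from above, the side on which minimality is
used. -/
lemma mul_sub_le_primitiveG_sub (hg : Continuous g) (hm : Monotone g) (x y : ℝ) :
    g x * (y - x) ≤ primitiveG g y - primitiveG g x := by
  rw [primitiveG_sub hg]
  rcases le_total x y with h | h
  · have h1 : ∫ s in x..y, g x ≤ ∫ s in x..y, g s :=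
      intervalIntegral.integral_mono_on h (by simp) (hg.intervalIntegrable _ _)
        fun s hs => hm hs.1
    rw [intervalIntegral.integral_const, smul_eq_mul] at h1
    linarith
  · rw [intervalIntegral.integral_symm]
    have h1 : ∫ s in y..x, g s ≤ ∫ s in y..x, g x :=
      intervalIntegral.integral_mono_on h (hg.intervalIntegrable _ _) (by simp)
        fun s hs => hm hs.2
    rw [intervalIntegral.integral_const, smul_eq_mul] at h1
    linarith

lemma abs_primitiveG_sub_le {C : ℝ} (hg : Continuous g) (hC : ∀ s, |g s| ≤ C) (x y : ℝ) :
    |primitiveG g y - primitiveG g x| ≤ C * |y - x| := by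
  rw [primitiveG_sub hg, ← Real.norm_eq_abs]
  exact intervalIntegral.norm_integral_le_of_norm_le_const fun s _ => hC s

end Primitive

/-! ### First variation of the action on the nonnegative cone. -/

section Action

variable {g q u v ξ : ℝ → ℝ} {a b : ℝ}

lemma intervalIntegrable_of_continuousOn_Icc {f : ℝ → ℝ} (hab : a ≤ b)
    (hf : ContinuousOn f (Icc a b)) : IntervalIntegrable f volume a b :=
  ContinuousOn.intervalIntegrable (by rwa [uIcc_of_le hab])

lemma intervalIntegrable_mul_continuousOn {f h : ℝ → ℝ} (hab : a ≤ b)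
    (hf : IntervalIntegrable f volume a b) (hh : ContinuousOn h (Icc a b)) :
    IntervalIntegrable (fun t => f t * h t) volume a b :=
  hf.mul_continuousOn (by rwa [uIcc_of_le hab])

lemma intervalIntegrable_action (hab : a ≤ b) (hg : Continuous g)
    (hq : IntervalIntegrable q volume a b) (hu : u ∈ H10 a b) :
    IntervalIntegrable (fun t => (1 / 2) * deriv u t ^ 2 - primitiveG g (u t) + q t * u t)
      volume a b := by
  refine (((H10.intervalIntegrable_deriv_sq hab hu).const_mul _).sub ?_).add
    (intervalIntegrable_mul_continuousOn hab hq (H10.continuousOn hu hab))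
  exact intervalIntegrable_of_continuousOn_Icc hab
    ((continuous_primitiveG hg).comp_continuousOn (H10.continuousOn hu hab))

/-- The increment of the action in the direction `φ`. -/
lemma action_add_sub {φ : ℝ → ℝ} (hab : a ≤ b) (hg : Continuous g)
    (hq : IntervalIntegrable q volume a b) (hu : u ∈ H10 a b) (hφ : φ ∈ H10 a b) :
    action g q a b (fun t => u t + φ t) - action g q a b u =
      (∫ t in a..b, deriv u t * deriv φ t) + (1 / 2) * (∫ t in a..b, deriv φ t ^ 2)
        - (∫ t in a..b, (primitiveG g (u t + φ t) - primitiveG g (u t)))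
        + ∫ t in a..b, q t * φ t := by
  have hs := H10.add hab hu hφ
  have i1 := H10.intervalIntegrable_deriv_mul hab hu hφ
  have i2 := (H10.intervalIntegrable_deriv_sq hab hφ).const_mul (1 / 2)
  have cG := continuous_primitiveG hg
  have i3 : IntervalIntegrable (fun t => primitiveG g (u t + φ t) - primitiveG g (u t)) volume a b :=
    intervalIntegrable_of_continuousOn_Icc hab
      ((cG.comp_continuousOn (H10.continuousOn hs hab)).sub
        (cG.comp_continuousOn (H10.continuousOn hu hab)))
  have i4 := intervalIntegrable_mul_continuousOn hab hq (H10.continuousOn hφ hab)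
  rw [action, action, ← intervalIntegral.integral_sub (intervalIntegrable_action hab hg hq hs)
    (intervalIntegrable_action hab hg hq hu), ← intervalIntegral.integral_const_mul,
    ← intervalIntegral.integral_add i1 i2, ← intervalIntegral.integral_sub (i1.add i2) i3,
    ← intervalIntegral.integral_add ((i1.add i2).sub i3) i4]
  refine integral_congr_ae_Icc hab ?_
  filter_upwards [ae_deriv_add hab hu.1 hφ.1] with t ht hm
  rw [ht hm]
  ring

/-- The action of a minimizer does not decrease in an admissible direction, to first order. -/
lemma IsMinimizer.first_variation (hab : a ≤ b) (hg : Continuous g) (hmono : Monotone g)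
    (hq : IntervalIntegrable q volume a b) (hu : IsMinimizer g q a b u) (hξ : ξ ∈ H10 a b)
    {s : ℝ} (hs : ∀ t ∈ Icc a b, 0 ≤ u t + s * ξ t) :
    0 ≤ s * ((∫ t in a..b, deriv u t * deriv ξ t) + ∫ t in a..b, (q t - g (u t)) * ξ t)
      + s ^ 2 * ((1 / 2) * ∫ t in a..b, deriv ξ t ^ 2) := by
  have hu0 := hu.1.1
  have hsξ := H10.const_mul hξ s
  have hsum := H10.add hab hu0 hsξ
  have hmin : action g q a b u ≤ action g q a b (fun t => u t + s * ξ t) :=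
    hu.2 (show (fun t => u t + s * ξ t) ∈ H10plus a b from ⟨hsum, hs⟩)
  have hexp := action_add_sub hab hg hq hu0 hsξ
  have hder : ∀ t, deriv (fun t => s * ξ t) t = s * deriv ξ t := fun t => deriv_const_mul_field s
  simp only [hder] at hexp
  have cu := H10.continuousOn hu0 hab
  have cξ := H10.continuousOn hξ hab
  have cgu : ContinuousOn (fun t => g (u t)) (Icc a b) := hg.comp_continuousOn cu
  have i2 : IntervalIntegrable (fun t => g (u t) * ξ t) volume a b :=
    intervalIntegrable_of_continuousOn_Icc hab (cgu.mul cξ)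
  have i1 := i2.const_mul s
  have cG := continuous_primitiveG hg
  have i3 : IntervalIntegrable (fun t => primitiveG g (u t + s * ξ t) - primitiveG g (u t))
      volume a b :=
    intervalIntegrable_of_continuousOn_Icc hab
      ((cG.comp_continuousOn (H10.continuousOn hsum hab)).sub (cG.comp_continuousOn cu))
  have hconv : ∫ t in a..b, s * (g (u t) * ξ t) ≤
      ∫ t in a..b, (primitiveG g (u t + s * ξ t) - primitiveG g (u t)) :=
    intervalIntegral.integral_mono_on hab i1 i3 fun t _ => by
      have := mul_sub_le_primitiveG_sub hg hmono (u t) (u t + s * ξ t)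
      linarith
  have e1 : ∫ t in a..b, deriv u t * (s * deriv ξ t) = s * ∫ t in a..b, deriv u t * deriv ξ t := by
    rw [← intervalIntegral.integral_const_mul]
    exact intervalIntegral.integral_congr fun t _ => by ring
  have e2 : ∫ t in a..b, (s * deriv ξ t) ^ 2 = s ^ 2 * ∫ t in a..b, deriv ξ t ^ 2 := by
    rw [← intervalIntegral.integral_const_mul]
    exact intervalIntegral.integral_congr fun t _ => by ring
  have e3 : ∫ t in a..b, q t * (s * ξ t) = s * ∫ t in a..b, q t * ξ t := by
    rw [← intervalIntegral.integral_const_mul]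
    exact intervalIntegral.integral_congr fun t _ => by ring
  have e4 : ∫ t in a..b, (q t - g (u t)) * ξ t =
      (∫ t in a..b, q t * ξ t) - ∫ t in a..b, g (u t) * ξ t := by
    rw [← intervalIntegral.integral_sub (intervalIntegrable_mul_continuousOn hab hq cξ) i2]
    exact intervalIntegral.integral_congr fun t _ => by ring
  rw [intervalIntegral.integral_const_mul] at hconv
  rw [e1, e2, e3] at hexp
  rw [e4]
  nlinarith

/-- The variational inequality. -/
lemma IsMinimizer.variational_inequality (hab : a ≤ b) (hg : Continuous g) (hmono : Monotone g)
    (hq : IntervalIntegrable q volume a b) (hu : IsMinimizer g q a b u) (hξ : ξ ∈ H10 a b)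
    (hpos : ∀ t ∈ Icc a b, 0 ≤ ξ t) :
    0 ≤ (∫ t in a..b, deriv u t * deriv ξ t) + ∫ t in a..b, (q t - g (u t)) * ξ t := by
  set B := (∫ t in a..b, deriv u t * deriv ξ t) + ∫ t in a..b, (q t - g (u t)) * ξ t
  set N := (1 / 2) * ∫ t in a..b, deriv ξ t ^ 2 with hN
  have hN0 : 0 ≤ N :=
    mul_nonneg (by norm_num) (intervalIntegral.integral_nonneg hab fun t _ => sq_nonneg _)
  by_contra! hB
  -- Small enough that `B + s * N < 0`; the summand 1 keeps the denominator positive when `N = 0`.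
  set s := -B / (2 * (N + 1)) with hs
  have hs0 : 0 < s := by
    apply div_pos <;> linarith
  have h1 := hu.first_variation hab hg hmono hq hξ (s := s) fun t ht =>
    add_nonneg (hu.1.2 t ht) (mul_nonneg hs0.le (hpos t ht))
  have h2 : s * (2 * (N + 1)) = -B := by
    rw [hs]
    field_simp
  change 0 ≤ s * B + s ^ 2 * N at h1
  have h3 : s * B + s ^ 2 * N = s * (B + s * N) := by ring
  rw [h3] at h1
  have h4 : 0 ≤ B + s * N := nonneg_of_mul_nonneg_right h1 hs0
  nlinarith

/-- The Euler equation, for directions that are admissible in both senses. -/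
lemma IsMinimizer.euler_equation (hab : a ≤ b) (hg : Continuous g) (hmono : Monotone g)
    (hq : IntervalIntegrable q volume a b) (hu : IsMinimizer g q a b u) (hξ : ξ ∈ H10 a b)
    (hpos : ∀ t ∈ Icc a b, 0 ≤ ξ t) {δ : ℝ} (hδ : 0 < δ)
    (hsub : ∀ t ∈ Icc a b, δ * ξ t ≤ u t) :
    (∫ t in a..b, deriv u t * deriv ξ t) + ∫ t in a..b, (q t - g (u t)) * ξ t = 0 := by
  refine le_antisymm ?_ (hu.variational_inequality hab hg hmono hq hξ hpos)
  set B := (∫ t in a..b, deriv u t * deriv ξ t) + ∫ t in a..b, (q t - g (u t)) * ξ t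
  set N := (1 / 2) * ∫ t in a..b, deriv ξ t ^ 2 with hN
  have hN0 : 0 ≤ N :=
    mul_nonneg (by norm_num) (intervalIntegral.integral_nonneg hab fun t _ => sq_nonneg _)
  by_contra! hB
  -- The cap `δ` keeps `u - s * ξ` nonnegative.
  set s := min δ (B / (2 * (N + 1))) with hs
  have hs0 : 0 < s := lt_min hδ (div_pos hB (by linarith))
  have h1 := hu.first_variation hab hg hmono hq hξ (s := -s) fun t ht => by
    have := mul_le_mul_of_nonneg_right (min_le_left δ (B / (2 * (N + 1)))) (hpos t ht)
    have := hsub t ht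
    rw [hs]
    linarith
  have h2 : s * (2 * (N + 1)) ≤ B := by
    rw [← le_div_iff₀ (by linarith)]
    exact min_le_right _ _
  change 0 ≤ -s * B + (-s) ^ 2 * N at h1
  have h3 : -s * B + (-s) ^ 2 * N = s * (s * N - B) := by ring
  rw [h3] at h1
  have h4 : 0 ≤ s * N - B := nonneg_of_mul_nonneg_right h1 hs0
  nlinarith

end Action

/-! ### Tents as test functions. -/

/-- The piecewise linear function with value `1` at `y` that vanishes outside `(x, z)`. -/
def tent (x y z t : ℝ) : ℝ := max 0 (min ((t - x) / (y - x)) ((z - t) / (z - y)))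

section Tent

variable {a b x y z t : ℝ}

lemma tent_nonneg (x y z t : ℝ) : 0 ≤ tent x y z t := le_max_left _ _

lemma tent_le_one (hxy : x < y) (hyz : y < z) : tent x y z t ≤ 1 := by
  refine max_le zero_le_one ?_
  rcases le_total t y with h | h
  · exact (min_le_left _ _).trans ((div_le_one (by linarith)).2 (by linarith))
  · exact (min_le_right _ _).trans ((div_le_one (by linarith)).2 (by linarith))

lemma tent_of_le_left (hxy : x < y) (h : t ≤ x) : tent x y z t = 0 :=
  max_eq_left ((min_le_left _ _).trans (div_nonpos_of_nonpos_of_nonneg (by linarith) (by linarith)))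

lemma tent_of_right_le (hyz : y < z) (h : z ≤ t) : tent x y z t = 0 :=
  max_eq_left ((min_le_right _ _).trans
    (div_nonpos_of_nonpos_of_nonneg (by linarith) (by linarith)))

lemma tent_of_mem_left (hxy : x < y) (hyz : y < z) (h : t ∈ Icc x y) :
    tent x y z t = (t - x) / (y - x) := by
  have h1 : (t - x) / (y - x) ≤ 1 := (div_le_one (by linarith)).2 (by linarith [h.2])
  have h2 : 1 ≤ (z - t) / (z - y) := (one_le_div (by linarith)).2 (by linarith [h.2])
  rw [tent, min_eq_left (h1.trans h2)]
  exact max_eq_right (div_nonneg (by linarith [h.1]) (by linarith))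

lemma tent_of_mem_right (hxy : x < y) (hyz : y < z) (h : t ∈ Icc y z) :
    tent x y z t = (z - t) / (z - y) := by
  have h1 : 1 ≤ (t - x) / (y - x) := (one_le_div (by linarith)).2 (by linarith [h.1])
  have h2 : (z - t) / (z - y) ≤ 1 := (div_le_one (by linarith)).2 (by linarith [h.1])
  rw [tent, min_eq_right (h2.trans h1)]
  exact max_eq_right (div_nonneg (by linarith [h.2]) (by linarith))

lemma exists_lipschitzWith_tent (x y z : ℝ) : ∃ K, LipschitzWith K (tent x y z) := by
  have lin : ∀ c d : ℝ, ∃ K, LipschitzWith K fun t : ℝ => c * t + d := fun c d => by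
    refine ⟨‖c‖₊, LipschitzWith.of_dist_le_mul fun s t => ?_⟩
    rw [Real.dist_eq, Real.dist_eq, coe_nnnorm, Real.norm_eq_abs, ← abs_mul]
    exact le_of_eq (congrArg _ (by ring))
  obtain ⟨K₁, h₁⟩ := lin (1 / (y - x)) (-x / (y - x))
  obtain ⟨K₂, h₂⟩ := lin (-1 / (z - y)) (z / (z - y))
  have e : tent x y z =
      fun t => max 0 (min (1 / (y - x) * t + -x / (y - x)) (-1 / (z - y) * t + z / (z - y))) := by
    funext t
    rw [tent]
    congr 2 <;> ring
  rw [e]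
  exact ⟨_, (h₁.min h₂).const_max 0⟩

lemma deriv_tent_left (hxy : x < y) (hyz : y < z) (h : t ∈ Ioo x y) :
    deriv (tent x y z) t = 1 / (y - x) := by
  have e : tent x y z =ᶠ[𝓝 t] fun s => (s - x) / (y - x) := by
    filter_upwards [Ioo_mem_nhds h.1 h.2] with s hs
    exact tent_of_mem_left hxy hyz (Ioo_subset_Icc_self hs)
  rw [e.deriv_eq]
  exact (((hasDerivAt_id t).sub_const x).div_const (y - x)).deriv

lemma deriv_tent_right (hxy : x < y) (hyz : y < z) (h : t ∈ Ioo y z) :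
    deriv (tent x y z) t = -(1 / (z - y)) := by
  have e : tent x y z =ᶠ[𝓝 t] fun s => (z - s) / (z - y) := by
    filter_upwards [Ioo_mem_nhds h.1 h.2] with s hs
    exact tent_of_mem_right hxy hyz (Ioo_subset_Icc_self hs)
  rw [e.deriv_eq, ← neg_div]
  exact (((hasDerivAt_id t).const_sub z).div_const (z - y)).deriv

lemma deriv_tent_of_lt (hxy : x < y) (h : t < x) : deriv (tent x y z) t = 0 := by
  have e : tent x y z =ᶠ[𝓝 t] fun _ => 0 := by
    filter_upwards [Iio_mem_nhds h] with s hs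
    exact tent_of_le_left hxy (le_of_lt hs)
  rw [e.deriv_eq, deriv_const]

lemma deriv_tent_of_gt (hyz : y < z) (h : z < t) : deriv (tent x y z) t = 0 := by
  have e : tent x y z =ᶠ[𝓝 t] fun _ => 0 := by
    filter_upwards [Ioi_mem_nhds h] with s hs
    exact tent_of_right_le hyz (le_of_lt hs)
  rw [e.deriv_eq, deriv_const]

lemma tent_mem_H10 (hax : a ≤ x) (hxy : x < y) (hyz : y < z) (hzb : z ≤ b) :
    tent x y z ∈ H10 a b := by
  obtain ⟨K, hK⟩ := exists_lipschitzWith_tent x y z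
  exact mem_H10_of_lipschitzWith hK (tent_of_le_left hxy hax) (tent_of_right_le hyz hzb)

lemma integral_mul_of_eq_const {F D : ℝ → ℝ} {c d k : ℝ} (hcd : c ≤ d)
    (hF : IntervalIntegrable F volume c d) (hD : ∀ t ∈ Ioo c d, D t = k) :
    IntervalIntegrable (fun t => F t * D t) volume c d ∧
      ∫ t in c..d, F t * D t = k * ∫ t in c..d, F t := by
  have hae : ∀ᵐ t, t ∈ Icc c d → k * F t = F t * D t := by
    filter_upwards [ae_mem_Ioo_of_mem_Icc c d] with t ht hm
    rw [hD t (ht hm), mul_comm]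
  refine ⟨(hF.const_mul k).congr_ae ?_, ?_⟩
  · rw [uIoc_of_le hcd]
    refine (ae_restrict_iff' measurableSet_Ioc).2 ?_
    filter_upwards [hae] with t ht hm using ht (Ioc_subset_Icc_self hm)
  · rw [← intervalIntegral.integral_const_mul]
    exact (integral_congr_ae_Icc hcd hae).symm

lemma integral_mul_deriv_tent {F : ℝ → ℝ} (hax : a ≤ x) (hxy : x < y) (hyz : y < z) (hzb : z ≤ b)
    (hF : IntervalIntegrable F volume a b) :
    ∫ t in a..b, F t * deriv (tent x y z) t =
      (∫ t in x..y, F t) / (y - x) - (∫ t in y..z, F t) / (z - y) := by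
  have hab : a ≤ b := by linarith
  have sub : ∀ c d, a ≤ c → c ≤ d → d ≤ b → IntervalIntegrable F volume c d := fun c d h1 h2 h3 =>
    hF.mono_set (by rw [uIcc_of_le h2, uIcc_of_le hab]; exact Icc_subset_Icc h1 h3)
  obtain ⟨i1, e1⟩ := integral_mul_of_eq_const hax (sub a x le_rfl hax (by linarith))
    (D := deriv (tent x y z)) fun t ht => deriv_tent_of_lt hxy ht.2
  obtain ⟨i2, e2⟩ := integral_mul_of_eq_const hxy.le (sub x y hax hxy.le (by linarith))
    (D := deriv (tent x y z)) fun t ht => deriv_tent_left hxy hyz ht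
  obtain ⟨i3, e3⟩ := integral_mul_of_eq_const hyz.le (sub y z (by linarith) hyz.le hzb)
    (D := deriv (tent x y z)) fun t ht => deriv_tent_right hxy hyz ht
  obtain ⟨i4, e4⟩ := integral_mul_of_eq_const hzb (sub z b (by linarith) hzb le_rfl)
    (D := deriv (tent x y z)) fun t ht => deriv_tent_of_gt hyz ht.1
  rw [← intervalIntegral.integral_add_adjacent_intervals ((i1.trans i2).trans i3) i4,
    ← intervalIntegral.integral_add_adjacent_intervals (i1.trans i2) i3,
    ← intervalIntegral.integral_add_adjacent_intervals i1 i2, e1, e2, e3, e4]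
  ring

lemma integral_deriv_mul_deriv_tent {F : ℝ → ℝ} (hax : a ≤ x) (hxy : x < y) (hyz : y < z)
    (hzb : z ≤ b) (hF : AbsolutelyContinuousOnInterval F a b) :
    ∫ t in a..b, deriv F t * deriv (tent x y z) t =
      (F y - F x) / (y - x) - (F z - F y) / (z - y) := by
  have hab : a ≤ b := by linarith
  have sub : ∀ c d, a ≤ c → c ≤ d → d ≤ b → AbsolutelyContinuousOnInterval F c d :=
    fun c d h1 h2 h3 =>
      hF.mono (by rw [uIcc_of_le h2, uIcc_of_le hab]; exact Icc_subset_Icc h1 h3)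
  rw [integral_mul_deriv_tent hax hxy hyz hzb hF.intervalIntegrable_deriv,
    (sub x y hax hxy.le (by linarith)).integral_deriv_eq_sub,
    (sub y z (by linarith) hyz.le hzb).integral_deriv_eq_sub]

lemma integral_deriv_tent_sq (hax : a ≤ x) (hxy : x < y) (hyz : y < z) (hzb : z ≤ b) :
    ∫ t in a..b, deriv (tent x y z) t ^ 2 = 1 / (y - x) + 1 / (z - y) := by
  have h := integral_deriv_mul_deriv_tent hax hxy hyz hzb (tent_mem_H10 hax hxy hyz hzb).1
  rw [tent_of_le_left hxy le_rfl, tent_of_right_le hyz le_rfl,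
    tent_of_mem_left hxy hyz (right_mem_Icc.2 hxy.le), div_self (by linarith)] at h
  simp only [sq]
  rw [h]
  ring

/-- Integration by parts leaves only two means of the primitive. A bound on `Q` therefore bounds the
integral independently of the width of the tent. -/
lemma integral_mul_tent {h Q : ℝ → ℝ} (hax : a ≤ x) (hxy : x < y) (hyz : y < z) (hzb : z ≤ b)
    (hh : IntervalIntegrable h volume a b) (hQ : ∀ t ∈ Icc a b, Q t = Q a + ∫ s in a..t, h s) :
    ∫ t in a..b, h t * tent x y z t =
      (∫ t in y..z, Q t) / (z - y) - (∫ t in x..y, Q t) / (y - x) := by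
  have hab : a ≤ b := by linarith
  rw [H10.integral_mul_eq_neg hab (tent_mem_H10 hax hxy hyz hzb) hh hQ]
  have hc : ContinuousOn Q (Icc a b) := by
    refine ContinuousOn.congr ?_ hQ
    refine continuousOn_const.add ?_
    have := intervalIntegral.continuousOn_primitive_interval
      ((intervalIntegrable_iff_integrableOn_Icc_of_le hab).1 hh |>.mono_set
        (uIcc_of_le hab).subset)
    rwa [uIcc_of_le hab] at this
  rw [integral_mul_deriv_tent hax hxy hyz hzb (intervalIntegrable_of_continuousOn_Icc hab hc)]
  ring

lemma integral_tent (hax : a ≤ x) (hxy : x < y) (hyz : y < z) (hzb : z ≤ b) :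
    ∫ t in a..b, tent x y z t = (z - x) / 2 := by
  -- For the primitive `t` of 1 the two means are the midpoints of `[y, z]` and `[x, y]`.
  have h := integral_mul_tent (h := fun _ => 1) (Q := fun t => t) hax hxy hyz hzb (by simp)
    fun t _ => by simp
  simp only [one_mul, integral_id] at h
  have h1 : z - y ≠ 0 := by linarith
  have h2 : y - x ≠ 0 := by linarith
  rw [h]
  field_simp
  ring

end Tent

/-! ### Concavity and regularity of minimizers. -/

section Concavity

variable {g q u : ℝ → ℝ} {a b x y z : ℝ}

/-- The primitive of `q - g ∘ u` that vanishes at `a`. -/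
def forcePrimitive (g q u : ℝ → ℝ) (a t : ℝ) : ℝ := ∫ s in a..t, (q s - g (u s))

lemma intervalIntegrable_force (hab : a ≤ b) (hg : Continuous g)
    (hq : IntervalIntegrable q volume a b) (hu : ContinuousOn u (Icc a b)) :
    IntervalIntegrable (fun t => q t - g (u t)) volume a b :=
  hq.sub (intervalIntegrable_of_continuousOn_Icc hab (hg.comp_continuousOn hu))

lemma integral_mul_tent_force (hax : a ≤ x) (hxy : x < y) (hyz : y < z) (hzb : z ≤ b)
    (hg : Continuous g) (hq : IntervalIntegrable q volume a b) (hu : u ∈ H10 a b) :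
    (∫ t in a..b, deriv u t * deriv (tent x y z) t) +
        ∫ t in a..b, (q t - g (u t)) * tent x y z t =
      (u y - u x - ∫ t in x..y, forcePrimitive g q u a t) / (y - x) -
      (u z - u y - ∫ t in y..z, forcePrimitive g q u a t) / (z - y) := by
  have hab : a ≤ b := by linarith
  rw [integral_deriv_mul_deriv_tent hax hxy hyz hzb hu.1,
    integral_mul_tent hax hxy hyz hzb
      (intervalIntegrable_force hab hg hq (H10.continuousOn hu hab))
      (Q := forcePrimitive g q u a) fun t _ => by simp [forcePrimitive]]
  ring

/-- The variational inequality for a tent is a comparison of adjacent slopes, so `u` minus the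
primitive of `forcePrimitive` is concave on `[a, b]`. Zeros of `u` and the endpoints are allowed. -/
lemma IsMinimizer.slope_le (hax : a ≤ x) (hxy : x < y) (hyz : y < z) (hzb : z ≤ b)
    (hg : Continuous g) (hmono : Monotone g) (hq : IntervalIntegrable q volume a b)
    (hu : IsMinimizer g q a b u) :
    (u z - u y - ∫ t in y..z, forcePrimitive g q u a t) / (z - y) ≤
      (u y - u x - ∫ t in x..y, forcePrimitive g q u a t) / (y - x) := by
  have h := hu.variational_inequality (by linarith) hg hmono hq (tent_mem_H10 hax hxy hyz hzb)
    fun t _ => tent_nonneg x y z t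
  rw [integral_mul_tent_force hax hxy hyz hzb hg hq hu.1.1] at h
  linarith

/-- Away from the endpoints a positive `u` has a positive minimum on `[x, z]`, so a small multiple
of the tent can be subtracted as well as added. -/
lemma IsMinimizer.slope_eq (hax : a < x) (hxy : x < y) (hyz : y < z) (hzb : z < b)
    (hg : Continuous g) (hmono : Monotone g) (hq : IntervalIntegrable q volume a b)
    (hu : IsMinimizer g q a b u) (hpos : ∀ t ∈ Ioo a b, 0 < u t) :
    (u z - u y - ∫ t in y..z, forcePrimitive g q u a t) / (z - y) =
      (u y - u x - ∫ t in x..y, forcePrimitive g q u a t) / (y - x) := by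
  have hab : a ≤ b := by linarith
  obtain ⟨t₀, ht₀, hmin⟩ := isCompact_Icc.exists_isMinOn (nonempty_Icc.2 (hxy.trans hyz).le)
    ((H10.continuousOn hu.1.1 hab).mono (Icc_subset_Icc hax.le hzb.le))
  have h := hu.euler_equation hab hg hmono hq (tent_mem_H10 hax.le hxy hyz hzb.le)
    (fun t _ => tent_nonneg x y z t) (hpos t₀ ⟨by linarith [ht₀.1], by linarith [ht₀.2]⟩)
    fun t ht => by
      have h0 := (hpos t₀ ⟨by linarith [ht₀.1], by linarith [ht₀.2]⟩).le
      rcases le_total t x with h1 | h1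
      · rw [tent_of_le_left hxy h1, mul_zero]
        exact hu.1.2 t ht
      rcases le_total z t with h2 | h2
      · rw [tent_of_right_le hyz h2, mul_zero]
        exact hu.1.2 t ht
      · exact (mul_le_of_le_one_right h0 (tent_le_one hxy hyz)).trans (hmin ⟨h1, h2⟩)
  rw [integral_mul_tent_force hax.le hxy hyz hzb.le hg hq hu.1.1] at h
  linarith

end Concavity

section Regularity

variable {g q u : ℝ → ℝ} {a b : ℝ}

/-- Two interior points fix the line, equality of slopes puts every other interior point on it, and
continuity adds the endpoints. -/
lemma exists_affine_of_slope_eq {U : ℝ → ℝ} (hab : a < b) (hU : ContinuousOn U (Icc a b))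
    (hs : ∀ x y z, a < x → x < y → y < z → z < b →
      (U z - U y) / (z - y) = (U y - U x) / (y - x)) :
    ∃ α β : ℝ, ∀ t ∈ Icc a b, U t = α + β * t := by
  obtain ⟨m, hm⟩ := exists_between hab
  obtain ⟨n, hn⟩ := exists_between hm.2
  set β := (U n - U m) / (n - m) with hβ
  have hnm : β * (n - m) = U n - U m := by
    rw [hβ, div_mul_cancel₀]
    linarith
  refine ⟨U m - β * m, β, ?_⟩
  have key : ∀ x y z, a < x → x < y → y < z → z < b →
      (U z - U y) * (y - x) = (U y - U x) * (z - y) := fun x y z h1 h2 h3 h4 => by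
    have h := hs x y z h1 h2 h3 h4
    rwa [div_eq_div_iff (by linarith) (by linarith)] at h
  have hin : EqOn U (fun t => U m - β * m + β * t) (Ioo a b) := by
    intro t ht
    simp only
    have hnm0 : n - m ≠ 0 := by linarith [hn.1]
    refine mul_right_cancel₀ hnm0 ?_
    rcases lt_trichotomy t m with h | h | h
    · have := key t m n ht.1 h hn.1 hn.2
      linear_combination this + (m - t) * hnm
    · rw [h]
      ring
    · rcases lt_trichotomy t n with h' | h' | h'
      · have := key m t n hm.1 h h' hn.2
        linear_combination -this - (t - m) * hnm
      · rw [h']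
        linear_combination (m - n) * hnm
      · have := key m n t hm.1 hn.1 h' ht.2
        linear_combination this - (t - m) * hnm
  have hcl := hin.of_subset_closure (t := Icc a b) hU (by fun_prop) Ioo_subset_Icc_self
    (by rw [closure_Ioo hab.ne])
  exact fun t ht => hcl ht

lemma continuousOn_forcePrimitive (hab : a ≤ b) (hg : Continuous g)
    (hq : IntervalIntegrable q volume a b) (hu : ContinuousOn u (Icc a b)) :
    ContinuousOn (forcePrimitive g q u a) (Icc a b) := by
  have := ((intervalIntegrable_force hab hg hq
    hu).absolutelyContinuousOnInterval_intervalIntegral (c := a) (by simp)).continuousOn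
  rwa [uIcc_of_le hab] at this

lemma hasDerivWithinAt_integral_of_continuousOn {F : ℝ → ℝ} (hab : a ≤ b)
    (hF : ContinuousOn F (Icc a b)) {t : ℝ} (ht : t ∈ Icc a b) :
    HasDerivWithinAt (fun s => ∫ r in a..s, F r) (F t) (Icc a b) t := by
  -- Extending `F` by constants beyond the endpoints makes the fundamental theorem available there
  -- too, giving one-sided derivatives.
  set E := IccExtend hab ((Icc a b).domRestrict F) with hE
  have hEF : ∀ s ∈ Icc a b, E s = F s := fun s hs => by
    rw [hE, IccExtend_of_mem _ _ hs, domRestrict_apply]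
  have hc : Continuous E := (continuousOn_iff_continuous_domRestrict.1 hF).Icc_extend'
  have h := (hc.integral_hasStrictDerivAt a t).hasDerivAt.hasDerivWithinAt (s := Icc a b)
  rw [hEF t ht] at h
  have hint : ∀ s ∈ Icc a b, ∫ r in a..s, F r = ∫ r in a..s, E r := fun s hs =>
    intervalIntegral.integral_congr fun r hr => by
      rw [uIcc_of_le hs.1] at hr
      exact (hEF r ⟨hr.1, hr.2.trans hs.2⟩).symm
  exact h.congr hint (hint t ht)

lemma integral_forcePrimitive_sub (hab : a ≤ b) (hg : Continuous g)
    (hq : IntervalIntegrable q volume a b) (hu : ContinuousOn u (Icc a b)) {x y : ℝ}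
    (hx : x ∈ Icc a b) (hy : y ∈ Icc a b) :
    (∫ t in a..y, forcePrimitive g q u a t) - ∫ t in a..x, forcePrimitive g q u a t =
      ∫ t in x..y, forcePrimitive g q u a t := by
  have i : ∀ z ∈ Icc a b, IntervalIntegrable (forcePrimitive g q u a) volume a z := fun z hz =>
    intervalIntegrable_of_continuousOn_Icc hz.1
      ((continuousOn_forcePrimitive hab hg hq hu).mono (Icc_subset_Icc_right hz.2))
  exact intervalIntegral.integral_interval_sub_left (i y hy) (i x hx)

/-- A positive minimizer is, up to an affine function, the second primitive of the force. -/
lemma IsMinimizer.exists_eq_affine_add (hab : a < b) (hg : Continuous g) (hmono : Monotone g)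
    (hq : IntervalIntegrable q volume a b) (hu : IsMinimizer g q a b u)
    (hpos : ∀ t ∈ Ioo a b, 0 < u t) :
    ∃ α β : ℝ, ∀ t ∈ Icc a b, u t = α + β * t + ∫ s in a..t, forcePrimitive g q u a s := by
  have cu := H10.continuousOn hu.1.1 hab.le
  have cQ := continuousOn_forcePrimitive hab.le hg hq cu
  have cP : ContinuousOn (fun t => ∫ s in a..t, forcePrimitive g q u a s) (Icc a b) :=
    fun t ht => (hasDerivWithinAt_integral_of_continuousOn hab.le cQ ht).continuousWithinAt
  obtain ⟨α, β, h⟩ := exists_affine_of_slope_eq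
    (U := fun t => u t - ∫ s in a..t, forcePrimitive g q u a s) hab (cu.sub cP)
    fun x y z hx hxy hyz hz => by
      have h1 := hu.slope_eq hx hxy hyz hz hg hmono hq hpos
      have mx : x ∈ Icc a b := ⟨by linarith, by linarith⟩
      have my : y ∈ Icc a b := ⟨by linarith, by linarith⟩
      have mz : z ∈ Icc a b := ⟨by linarith, by linarith⟩
      rw [← integral_forcePrimitive_sub hab.le hg hq cu mx my,
        ← integral_forcePrimitive_sub hab.le hg hq cu my mz] at h1
      convert h1 using 2 <;> ring
  exact ⟨α, β, fun t ht => by linarith [h t ht]⟩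

/-- Regularity of positive minimizers. -/
lemma IsMinimizer.exists_derivative (hab : a < b) (hg : Continuous g) (hmono : Monotone g)
    (hq : IntervalIntegrable q volume a b) (hu : IsMinimizer g q a b u)
    (hpos : ∀ t ∈ Ioo a b, 0 < u t) :
    ∃ β : ℝ, ∀ t ∈ Icc a b, HasDerivWithinAt u (β + forcePrimitive g q u a t) (Icc a b) t := by
  obtain ⟨α, β, h⟩ := hu.exists_eq_affine_add hab hg hmono hq hpos
  refine ⟨β, fun t ht => ?_⟩
  have cQ := continuousOn_forcePrimitive hab.le hg hq (H10.continuousOn hu.1.1 hab.le)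
  have h1 := hasDerivWithinAt_integral_of_continuousOn hab.le cQ ht
  have h2 : HasDerivWithinAt (fun s => α + β * s) β (Icc a b) t := by
    simpa using (((hasDerivAt_id t).const_mul β).const_add α).hasDerivWithinAt
  exact (h2.add h1).congr h (h t ht)

lemma absolutelyContinuousOnInterval_const_add_forcePrimitive (hab : a ≤ b) (hg : Continuous g)
    (hq : IntervalIntegrable q volume a b) (hu : ContinuousOn u (Icc a b)) (β : ℝ) :
    AbsolutelyContinuousOnInterval (fun t => β + forcePrimitive g q u a t) a b :=
  ((LipschitzWith.const β).lipschitzOnWith (s := uIcc a b)).absolutelyContinuousOnInterval.add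
    ((intervalIntegrable_force hab hg hq
      hu).absolutelyContinuousOnInterval_intervalIntegral (c := a) (by simp))

lemma ae_hasDerivAt_const_add_forcePrimitive (hab : a ≤ b) (hg : Continuous g)
    (hq : IntervalIntegrable q volume a b) (hu : ContinuousOn u (Icc a b)) (β : ℝ) :
    ∀ᵐ t, t ∈ Icc a b →
      HasDerivAt (fun t => β + forcePrimitive g q u a t) (q t - g (u t)) t := by
  filter_upwards [(intervalIntegrable_force hab hg hq hu).ae_hasDerivAt_integral] with t ht hm
  rw [uIcc_of_le hab] at ht
  exact (ht hm a (left_mem_Icc.2 hab)).const_add β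

lemma IsMinimizer.solvesDirichlet (hab : a < b) (hg : Continuous g) (hmono : Monotone g)
    (hq : IntervalIntegrable q volume a b) (hu : IsMinimizer g q a b u)
    (hpos : ∀ t ∈ Ioo a b, 0 < u t) : SolvesDirichlet g q a b u := by
  obtain ⟨β, h⟩ := hu.exists_derivative hab hg hmono hq hpos
  have cu := H10.continuousOn hu.1.1 hab.le
  exact ⟨⟨fun t => β + forcePrimitive g q u a t,
    absolutelyContinuousOnInterval_const_add_forcePrimitive hab.le hg hq cu β, h,
    ae_restrict_Ioo_of_ae_Icc (ae_hasDerivAt_const_add_forcePrimitive hab.le hg hq cu β)⟩,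
    hu.1.1.2.2.1, hu.1.1.2.2.2, hpos⟩

lemma IsMinimizer.solvesDirichletClassically (hab : a < b) (hg : Continuous g)
    (hmono : Monotone g) (hq : IntervalIntegrable q volume a b) (hu : IsMinimizer g q a b u)
    (hpos : ∀ t ∈ Ioo a b, 0 < u t) (hqc : ContinuousOn q (Ioo a b)) :
    SolvesDirichletClassically g q a b u := by
  obtain ⟨β, h⟩ := hu.exists_derivative hab hg hmono hq hpos
  have cu := H10.continuousOn hu.1.1 hab.le
  have cu' := cu.mono (Ioo_subset_Icc_self)
  have ch : ContinuousOn (fun t => q t - g (u t)) (Ioo a b) := hqc.sub (hg.comp_continuousOn cu')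
  have d1 : ∀ t ∈ Ioo a b, HasDerivAt u (β + forcePrimitive g q u a t) t := fun t ht =>
    (h t (Ioo_subset_Icc_self ht)).hasDerivAt (Icc_mem_nhds ht.1 ht.2)
  have d2 : ∀ t ∈ Ioo a b,
      HasDerivAt (fun t => β + forcePrimitive g q u a t) (q t - g (u t)) t := fun t ht => by
    refine HasDerivAt.const_add β ?_
    refine intervalIntegral.integral_hasDerivAt_right ?_
      (ch.stronglyMeasurableAtFilter isOpen_Ioo t ht) (ch.continuousAt (isOpen_Ioo.mem_nhds ht))
    refine (intervalIntegrable_force hab.le hg hq cu).mono_set ?_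
    rw [uIcc_of_le ht.1.le, uIcc_of_le hab.le]
    exact Icc_subset_Icc_right ht.2.le
  have e1 : ∀ t ∈ Ioo a b, deriv u t = β + forcePrimitive g q u a t := fun t ht => (d1 t ht).deriv
  have d3 : ∀ t ∈ Ioo a b, HasDerivAt (deriv u) (q t - g (u t)) t := fun t ht => by
    refine (d2 t ht).congr_of_eventuallyEq ?_
    filter_upwards [isOpen_Ioo.mem_nhds ht] with s hs using e1 s hs
  refine ⟨?_, cu, fun t ht => by rw [(d3 t ht).deriv]; ring, hu.1.1.2.2.1, hu.1.1.2.2.2, hpos⟩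
  have c1 : ContDiffOn ℝ 1 (deriv u) (Ioo a b) := by
    rw [show (1 : WithTop ℕ∞) = 0 + 1 from (zero_add 1).symm,
      contDiffOn_succ_iff_deriv_of_isOpen isOpen_Ioo]
    refine ⟨fun t ht => (d3 t ht).differentiableAt.differentiableWithinAt, by simp, ?_⟩
    rw [contDiffOn_zero]
    exact ch.congr fun t ht => (d3 t ht).deriv
  rw [show (2 : WithTop ℕ∞) = 1 + 1 from one_add_one_eq_two.symm,
    contDiffOn_succ_iff_deriv_of_isOpen isOpen_Ioo]
  exact ⟨fun t ht => (d1 t ht).differentiableAt.differentiableWithinAt, by simp, c1⟩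

/-- The weak Euler equation for positive minimizers. -/
lemma IsMinimizer.weak_equation {φ : ℝ → ℝ} (hab : a < b) (hg : Continuous g)
    (hmono : Monotone g) (hq : IntervalIntegrable q volume a b) (hu : IsMinimizer g q a b u)
    (hpos : ∀ t ∈ Ioo a b, 0 < u t) (hφ : φ ∈ H10 a b) :
    ∫ t in a..b, deriv u t * deriv φ t = -∫ t in a..b, (q t - g (u t)) * φ t := by
  obtain ⟨β, h⟩ := hu.exists_derivative hab hg hmono hq hpos
  have cu := H10.continuousOn hu.1.1 hab.le
  -- The derivative of `u` is itself a primitive of the force, so integration by parts admits `φ` of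
  -- any sign and size.
  rw [H10.integral_mul_eq_neg hab.le hφ (intervalIntegrable_force hab.le hg hq cu)
    (Q := fun t => β + forcePrimitive g q u a t) (fun t _ => by simp [forcePrimitive]), neg_neg]
  refine integral_congr_ae_Icc hab.le ?_
  filter_upwards [ae_mem_Ioo_of_mem_Icc a b] with t ht hm
  rw [((h t hm).hasDerivAt (Icc_mem_nhds (ht hm).1 (ht hm).2)).deriv]

end Regularity

/-! ### Uniqueness of positive minimizers. -/

section Uniqueness

variable {g q u v m : ℝ → ℝ} {a b : ℝ}

/-- A strictly concave graph lies above its chord, so the trapezoidal rule underestimates the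
integral of `g`. -/
lemma trapezoid_lt_primitiveG_sub (hg : Continuous g) (hc : StrictConcaveOn ℝ (Ioi 0) g) {x y : ℝ}
    (hx : 0 < x) (hxy : x < y) :
    (1 / 2) * (g x + g y) * (y - x) < primitiveG g y - primitiveG g x := by
  have hd : 0 < y - x := by linarith
  set k := (g y - g x) / (y - x) with hk
  have hkd : k * (y - x) = g y - g x := div_mul_cancel₀ _ hd.ne'
  have hchord : ∀ t ∈ Ioo x y, g x + k * (t - x) < g t := fun t ht => by
    have h := hc.2 (mem_Ioi.2 hx) (mem_Ioi.2 (hx.trans hxy)) hxy.ne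
      (div_pos (sub_pos.2 ht.2) hd) (div_pos (sub_pos.2 ht.1) hd) (by field_simp; ring)
    have e1 : ((y - t) / (y - x)) • x + ((t - x) / (y - x)) • y = t := by
      simp only [smul_eq_mul]
      field_simp
      ring
    have e2 : ((y - t) / (y - x)) • g x + ((t - x) / (y - x)) • g y = g x + k * (t - x) := by
      simp only [smul_eq_mul, hk]
      field_simp
      ring
    rwa [e1, e2] at h
  have hint : ∫ t in x..y, (g x + k * (t - x)) = (1 / 2) * (g x + g y) * (y - x) := by
    rw [intervalIntegral.integral_add (by simp) (Continuous.intervalIntegrable (by fun_prop) _ _),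
      intervalIntegral.integral_const_mul, intervalIntegral.integral_sub (by simp) (by simp)]
    simp only [intervalIntegral.integral_const, integral_id, smul_eq_mul]
    linear_combination (y - x) / 2 * hkd
  rw [primitiveG_sub hg, ← hint]
  obtain ⟨c, hcm⟩ := exists_between hxy
  refine intervalIntegral.integral_lt_integral_of_continuousOn_of_le_of_exists_lt hxy
    (by fun_prop) hg.continuousOn (fun t ht => ?_) ⟨c, Ioo_subset_Icc_self hcm, hchord c hcm⟩
  rcases ht.2.eq_or_lt with h | h
  · rw [h]
    linarith
  · exact (hchord t ⟨ht.1, h⟩).le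

/-- At almost every point the maximum and the minimum, with their derivatives, are a permutation of
`u` and `v`. -/
lemma action_max_add_action_min (hab : a ≤ b) (hg : Continuous g)
    (hq : IntervalIntegrable q volume a b) (hu : u ∈ H10 a b) (hv : v ∈ H10 a b) :
    action g q a b (fun t => max (u t) (v t)) + action g q a b (fun t => min (u t) (v t)) =
      action g q a b u + action g q a b v := by
  rw [action, action, action, action,
    ← intervalIntegral.integral_add (intervalIntegrable_action hab hg hq (H10.max_mem hab hu hv))
      (intervalIntegrable_action hab hg hq (H10.min_mem hab hu hv)),
    ← intervalIntegral.integral_add (intervalIntegrable_action hab hg hq hu)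
      (intervalIntegrable_action hab hg hq hv)]
  refine integral_congr_ae_Icc hab ?_
  filter_upwards [ae_deriv_max_min hab hu.1 hv.1] with t ht hm
  rcases ht hm with ⟨h, e1, e2⟩ | ⟨h, e1, e2⟩
  · rw [e1, e2, max_eq_left h, min_eq_right h]
  · rw [e1, e2, max_eq_right h, min_eq_left h]
    ring

/-- The maximum and the minimum are both admissible and their actions sum to twice the least value,
so each attains it. -/
protected lemma IsMinimizer.max (hab : a ≤ b) (hg : Continuous g) (hq : IntervalIntegrable q volume a b)
    (hu : IsMinimizer g q a b u) (hv : IsMinimizer g q a b v) :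
    IsMinimizer g q a b (fun t => max (u t) (v t)) := by
  have hmax : (fun t => Max.max (u t) (v t)) ∈ H10plus a b :=
    ⟨H10.max_mem hab hu.1.1 hv.1.1, fun t ht => (hu.1.2 t ht).trans (le_max_left _ _)⟩
  have hmin : (fun t => Min.min (u t) (v t)) ∈ H10plus a b :=
    ⟨H10.min_mem hab hu.1.1 hv.1.1, fun t ht => le_min (hu.1.2 t ht) (hv.1.2 t ht)⟩
  refine ⟨hmax, fun z hz => ?_⟩
  have h1 := action_max_add_action_min hab hg hq hu.1.1 hv.1.1
  have h2 : action g q a b v ≤ _ := hv.2 hmin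
  have h3 : action g q a b u ≤ action g q a b z := hu.2 hz
  change action g q a b _ ≤ action g q a b z
  linarith

/-- Ordered positive minimizers coincide. -/
lemma IsMinimizer.eqOn_of_le (hab : a < b) (hg : Continuous g) (hmono : Monotone g)
    (hc : StrictConcaveOn ℝ (Ioi 0) g) (hq : IntervalIntegrable q volume a b)
    (hu : IsMinimizer g q a b u) (hm : IsMinimizer g q a b m)
    (hpos : ∀ t ∈ Ioo a b, 0 < u t) (hle : ∀ t ∈ Icc a b, u t ≤ m t) : EqOn u m (Icc a b) := by
  have hposm : ∀ t ∈ Ioo a b, 0 < m t := fun t ht =>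
    (hpos t ht).trans_le (hle t (Ioo_subset_Icc_self ht))
  have hw := H10.sub hab.le hm.1.1 hu.1.1
  have hact : action g q a b m = action g q a b u :=
    le_antisymm (hm.2 hu.1) (hu.2 hm.1)
  have hexp := action_add_sub hab.le hg hq hu.1.1 hw
  simp only [add_sub_cancel, hact, sub_self] at hexp
  have wu := hu.weak_equation hab hg hmono hq hpos hw
  have wm := hm.weak_equation hab hg hmono hq hposm hw
  have iu := H10.intervalIntegrable_deriv_mul hab.le hu.1.1 hw
  have im := H10.intervalIntegrable_deriv_mul hab.le hm.1.1 hw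
  have hsq : ∫ t in a..b, deriv (fun s => m s - u s) t ^ 2 =
      (∫ t in a..b, deriv m t * deriv (fun s => m s - u s) t) -
        ∫ t in a..b, deriv u t * deriv (fun s => m s - u s) t := by
    rw [← intervalIntegral.integral_sub im iu]
    refine integral_congr_ae_Icc hab.le ?_
    filter_upwards [ae_deriv_sub hab.le hm.1.1.1 hu.1.1.1] with t ht htm
    rw [ht htm]
    ring
  have cu := H10.continuousOn hu.1.1 hab.le
  have cm := H10.continuousOn hm.1.1 hab.le
  have cw := H10.continuousOn hw hab.le
  have cG := continuous_primitiveG hg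
  have cGG : ContinuousOn (fun t => primitiveG g (m t) - primitiveG g (u t)) (Icc a b) :=
    (cG.comp_continuousOn cm).sub (cG.comp_continuousOn cu)
  have cgu : ContinuousOn (fun t => g (u t)) (Icc a b) := hg.comp_continuousOn cu
  have cgm : ContinuousOn (fun t => g (m t)) (Icc a b) := hg.comp_continuousOn cm
  have ctr : ContinuousOn (fun t => (1 / 2) * (g (u t) + g (m t)) * (m t - u t)) (Icc a b) :=
    (continuousOn_const.mul (cgu.add cgm)).mul cw
  have ifu := intervalIntegrable_mul_continuousOn hab.le
    (intervalIntegrable_force hab.le hg hq cu) cw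
  have ifm := intervalIntegrable_mul_continuousOn hab.le
    (intervalIntegrable_force hab.le hg hq cm) cw
  have iqw := intervalIntegrable_mul_continuousOn hab.le hq cw
  have htr : ∫ t in a..b, (1 / 2) * (g (u t) + g (m t)) * (m t - u t) =
      (∫ t in a..b, q t * (m t - u t)) -
        (1 / 2) * ((∫ t in a..b, (q t - g (u t)) * (m t - u t)) +
          ∫ t in a..b, (q t - g (m t)) * (m t - u t)) := by
    rw [← intervalIntegral.integral_add ifu ifm, ← intervalIntegral.integral_const_mul,
      ← intervalIntegral.integral_sub iqw ((ifu.add ifm).const_mul _)]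
    exact intervalIntegral.integral_congr fun t _ => by ring
  -- By `hsq` the derivative terms of `hexp` are half the sum of the left sides of `wu` and `wm`.
  -- Replacing them by the right sides cancels `q` and leaves the trapezoidal error.
  have hzero : ∫ t in a..b, ((primitiveG g (m t) - primitiveG g (u t)) -
      (1 / 2) * (g (u t) + g (m t)) * (m t - u t)) = 0 := by
    rw [intervalIntegral.integral_sub (intervalIntegrable_of_continuousOn_Icc hab.le cGG)
      (intervalIntegrable_of_continuousOn_Icc hab.le ctr), htr]
    linarith
  have hstrict : ∀ t ∈ Ioo a b, u t < m t → 0 < (primitiveG g (m t) - primitiveG g (u t)) -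
      (1 / 2) * (g (u t) + g (m t)) * (m t - u t) := fun t ht hlt =>
    sub_pos.2 (trapezoid_lt_primitiveG_sub hg hc (hpos t ht) hlt)
  have hends : ∀ t ∈ Icc a b, u t < m t → t ∈ Ioo a b := fun t ht hlt => by
    refine ⟨lt_of_le_of_ne ht.1 ?_, lt_of_le_of_ne ht.2 ?_⟩
    · rintro rfl
      rw [hu.1.1.2.2.1, hm.1.1.2.2.1] at hlt
      exact lt_irrefl _ hlt
    · rintro rfl
      rw [hu.1.1.2.2.2, hm.1.1.2.2.2] at hlt
      exact lt_irrefl _ hlt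
  intro t ht
  by_contra hne
  have hlt := lt_of_le_of_ne (hle t ht) hne
  refine (intervalIntegral.integral_pos hab (cGG.sub ctr) (fun s hs => ?_)
    ⟨t, ht, hstrict t (hends t ht hlt) hlt⟩).ne' hzero
  have hs' := Ioc_subset_Icc_self hs
  rcases (hle s hs').eq_or_lt with h | h
  · simp [h]
  · exact (hstrict s (hends s hs' h) h).le

/-- Positive minimizers coincide. -/
theorem IsMinimizer.eqOn (hab : a < b) (hg : Continuous g) (hmono : Monotone g)
    (hc : StrictConcaveOn ℝ (Ioi 0) g) (hq : IntervalIntegrable q volume a b)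
    (hu : IsMinimizer g q a b u) (hv : IsMinimizer g q a b v)
    (hposu : ∀ t ∈ Ioo a b, 0 < u t) (hposv : ∀ t ∈ Ioo a b, 0 < v t) : EqOn u v (Icc a b) := by
  have hm := hu.max hab.le hg hq hv
  have h1 := hu.eqOn_of_le hab hg hmono hc hq hm hposu fun t _ => le_max_left _ _
  have h2 := hv.eqOn_of_le hab hg hmono hc hq hm hposv fun t _ => le_max_right _ _
  exact h1.trans h2.symm

end Uniqueness

/-! ### A priori bound on either side of an interior zero. -/

section APriori

variable {u Q : ℝ → ℝ} {a b c : ℝ} {C R k η : ℝ}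

lemma exists_last_le {t : ℝ} (hct : c ≤ t) (hu : ContinuousOn u (Icc c t)) (hc : u c ≤ R)
    (ht : R < u t) : ∃ s ∈ Ico c t, u s = R ∧ ∀ r ∈ Icc s t, R ≤ u r := by
  have hcomp : IsCompact (Icc c t ∩ u ⁻¹' Iic R) :=
    isCompact_Icc.of_isClosed_subset (hu.preimage_isClosed_of_isClosed isClosed_Icc isClosed_Iic)
      inter_subset_left
  obtain ⟨s, hs, hmax⟩ := hcomp.exists_isGreatest ⟨c, left_mem_Icc.2 hct, hc⟩
  have hst : s < t := lt_of_le_of_ne hs.1.2 fun h => by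
    have h2 : u s ≤ R := hs.2
    rw [h] at h2
    exact ht.not_ge h2
  have hus : u s = R := by
    obtain ⟨r, hr, hur⟩ := intermediate_value_Icc hst.le
      (hu.mono (Icc_subset_Icc_left hs.1.1)) ⟨hs.2, ht.le⟩
    have hrs : r ≤ s := hmax ⟨⟨hs.1.1.trans hr.1, hr.2⟩, hur.le⟩
    rwa [le_antisymm hrs hr.1] at hur
  refine ⟨s, ⟨hs.1.1, hst⟩, hus, fun r hr => ?_⟩
  by_contra! hlt
  have hrs : r ≤ s := hmax ⟨⟨hs.1.1.trans hr.1, hr.2⟩, hlt.le⟩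
  rw [le_antisymm hrs hr.1, hus] at hlt
  exact lt_irrefl _ hlt

/-- If `u` minus a primitive of `Q` is concave, `u ≥ 0` vanishes at an interior point `c`, and `Q`
decreases on average wherever `u` is large, then `u` is bounded to the right of `c`. -/
lemma le_of_zero_left (hac : a < c) (hcb : c ≤ b) (hη : 0 < η) (hR : 0 < R) (hC : 0 ≤ C)
    (hu : ContinuousOn u (Icc a b)) (hQ : ContinuousOn Q (Icc a b))
    (hpos : ∀ t ∈ Icc a b, 0 ≤ u t) (hc : u c = 0)
    (hslope : ∀ x y z, a ≤ x → x < y → y < z → z ≤ b →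
      (u z - u y - ∫ t in y..z, Q t) / (z - y) ≤ (u y - u x - ∫ t in x..y, Q t) / (y - x))
    (hQ₁ : ∀ r s, a ≤ r → r ≤ s → s ≤ b → Q s - Q r ≤ C * (s - r))
    (hQ₂ : ∀ r s, a ≤ r → r ≤ s → s ≤ b → (∀ t ∈ Icc r s, R ≤ u t) →
      Q s - Q r ≤ k - η * (s - r)) :
    ∀ t ∈ Icc c b, u t ≤ R + (R + 2 * C + k) ^ 2 / (2 * η) := by
  intro t ht
  rcases le_or_gt (u t) R with h | hRt
  · have : 0 ≤ (R + 2 * C + k) ^ 2 / (2 * η) := by positivity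
    linarith
  obtain ⟨s, hs, hus, hlarge⟩ := exists_last_le ht.1
    (hu.mono (Icc_subset_Icc hac.le ht.2)) (hc.le.trans hR.le) hRt
  have hcs : c < s := lt_of_le_of_ne hs.1 fun h => by rw [← h, hc] at hus; linarith
  have hst := hs.2
  have hQi : ∀ x y, a ≤ x → x ≤ y → y ≤ b → IntervalIntegrable Q volume x y := fun x y h1 h2 h3 =>
    intervalIntegrable_of_continuousOn_Icc h2 (hQ.mono (Icc_subset_Icc h1 h3))
  -- `Q` grows at rate at most `C`, so on a window reaching back at most 2 from `s` it is at least
  -- `Q s - 2 * C`.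
  have hlow : ∀ x y, a ≤ x → x ≤ y → y ≤ s → s ≤ x + 2 →
      (Q s - 2 * C) * (y - x) ≤ ∫ r in x..y, Q r := fun x y h1 h2 h3 h4 => by
    have h := intervalIntegral.integral_mono_on (f := fun _ => Q s - 2 * C) h2 (by simp)
      (hQi x y h1 h2 (by linarith [ht.2])) fun r hr => by
        have := hQ₁ r s (by linarith [hr.1]) (by linarith [hr.2]) (by linarith [ht.2])
        nlinarith [hr.1, hr.2]
    rw [intervalIntegral.integral_const, smul_eq_mul] at h
    linarith
  -- Concavity bounds this slope by an earlier one. If `c ≤ s - 1` the window is `[s - 1, s]`, on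
  -- which `u` gains at most `R`. Otherwise it is a window of length at most 1 ending at `c`, on
  -- which `u` gains nothing because `u c = 0`; it exists since `a < c`.
  have hD : (u t - u s - ∫ r in s..t, Q r) / (t - s) ≤ R + 2 * C - Q s := by
    rcases le_or_gt c (s - 1) with h | h
    · refine (hslope (s - 1) s t (by linarith) (by linarith) hst ht.2).trans ?_
      have h1 := hlow (s - 1) s (by linarith) (by linarith) le_rfl (by linarith)
      have h2 := hpos (s - 1) ⟨by linarith, by linarith [ht.2]⟩
      rw [sub_sub_cancel, div_one, hus]
      rw [sub_sub_cancel, mul_one] at h1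
      linarith
    · set x := max a (c - 1) with hx
      have hxc : x < c := max_lt hac (by linarith)
      have hax : a ≤ x := le_max_left _ _
      have hxc' : c - 1 ≤ x := le_max_right _ _
      refine (hslope c s t hac.le hcs hst ht.2).trans
        ((hslope x c s hax hxc hcs (by linarith [ht.2])).trans ?_)
      have h1 := hlow x c hax hxc.le hcs.le (by linarith)
      have h2 := hpos x ⟨hax, by linarith⟩
      rw [hc, div_le_iff₀ (by linarith)]
      nlinarith
  rw [div_le_iff₀ (by linarith), hus] at hD
  -- On `[s, t]` the function `u` stays above `R`, so the linear decay of `Q` applies and integrates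
  -- to a quadratic loss.
  have hup : ∫ r in s..t, Q r ≤ (Q s + k) * (t - s) - η * (t - s) ^ 2 / 2 := by
    have h := intervalIntegral.integral_mono_on (g := fun r => Q s + k - η * (r - s)) hst.le
      (hQi s t (by linarith) hst.le ht.2)
      (Continuous.intervalIntegrable (by fun_prop) _ _) fun r hr => by
        have := hQ₂ s r (by linarith) hr.1 (by linarith [hr.2, ht.2])
          fun w hw => hlarge w ⟨hw.1, hw.2.trans hr.2⟩
        linarith
    refine h.trans (le_of_eq ?_)
    rw [intervalIntegral.integral_sub (by simp) (Continuous.intervalIntegrable (by fun_prop) _ _),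
      intervalIntegral.integral_const_mul, intervalIntegral.integral_sub (by simp) (by simp)]
    simp only [intervalIntegral.integral_const, integral_id, smul_eq_mul]
    ring
  -- The right side is the maximum of the parabola in `t - s`, so the bound does not depend on the
  -- length of the interval.
  have hfin : (R + 2 * C + k) * (t - s) - η * (t - s) ^ 2 / 2 ≤
      (R + 2 * C + k) ^ 2 / (2 * η) := by
    rw [le_div_iff₀ (by positivity)]
    nlinarith [sq_nonneg (R + 2 * C + k - η * (t - s))]
  linarith

/-- The mirror image of `le_of_zero_left`. -/
lemma le_of_zero_right (hac : a ≤ c) (hcb : c < b) (hη : 0 < η) (hR : 0 < R) (hC : 0 ≤ C)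
    (hu : ContinuousOn u (Icc a b)) (hQ : ContinuousOn Q (Icc a b))
    (hpos : ∀ t ∈ Icc a b, 0 ≤ u t) (hc : u c = 0)
    (hslope : ∀ x y z, a ≤ x → x < y → y < z → z ≤ b →
      (u z - u y - ∫ t in y..z, Q t) / (z - y) ≤ (u y - u x - ∫ t in x..y, Q t) / (y - x))
    (hQ₁ : ∀ r s, a ≤ r → r ≤ s → s ≤ b → Q s - Q r ≤ C * (s - r))
    (hQ₂ : ∀ r s, a ≤ r → r ≤ s → s ≤ b → (∀ t ∈ Icc r s, R ≤ u t) →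
      Q s - Q r ≤ k - η * (s - r)) :
    ∀ t ∈ Icc a c, u t ≤ R + (R + 2 * C + k) ^ 2 / (2 * η) := by
  have hneg : MapsTo (fun t : ℝ => -t) (Icc (-b) (-a)) (Icc a b) := fun t ht =>
    ⟨by linarith [ht.2], by linarith [ht.1]⟩
  -- `Q` behaves like a first derivative and changes sign under reflection. Its increments, on which
  -- the hypotheses rest, keep their sign.
  have h := le_of_zero_left (u := fun t => u (-t)) (Q := fun t => -Q (-t)) (a := -b) (b := -a)
    (c := -c) (k := k) (by linarith) (by linarith) hη hR hC
    (hu.comp (by fun_prop) hneg) (hQ.comp (by fun_prop) hneg).neg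
    (fun t ht => hpos _ (hneg ht)) (by simpa using hc) ?_ ?_ ?_
  · intro t ht
    simpa using h (-t) ⟨by linarith [ht.2], by linarith [ht.1]⟩
  · intro x y z h1 h2 h3 h4
    have := hslope (-z) (-y) (-x) (by linarith) (by linarith) (by linarith) (by linarith)
    simp only [intervalIntegral.integral_neg, intervalIntegral.integral_comp_neg]
    have e1 : -x - -y = y - x := by ring
    have e2 : -y - -z = z - y := by ring
    rw [e1, e2] at this
    rw [← neg_le_neg_iff, ← neg_div, ← neg_div]
    convert this using 2 <;> ring
  · intro r s h1 h2 h3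
    have := hQ₁ (-s) (-r) (by linarith) (by linarith) (by linarith)
    linarith
  · intro r s h1 h2 h3 h4
    have := hQ₂ (-s) (-r) (by linarith) (by linarith) (by linarith) fun t ht => by
      simpa using h4 (-t) ⟨by linarith [ht.2], by linarith [ht.1]⟩
    linarith

end APriori

/-! ### Energy comparison and positivity on long intervals. -/

section Energy

variable {g q u : ℝ → ℝ} {a b c d : ℝ} {B C R k M H η : ℝ}

/-- A minimizer cannot stay below a fixed level on a long interval: adding a high tent would
decrease the action. -/
lemma IsMinimizer.not_bounded_of_long (hac : a ≤ c) (hcd : c < d) (hdb : d ≤ b)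
    (hg : Continuous g) (hmono : Monotone g) (hg0 : g 0 = 0) (hC : ∀ s, |g s| ≤ C)
    (hq : IntervalIntegrable q volume a b) (hu : IsMinimizer g q a b u)
    (hM : ∀ t ∈ Icc c d, u t ≤ M) (hR : 0 ≤ R) (hη : B + η ≤ g R) (hH : 0 ≤ H)
    (hEH : g R * R + C * M + 1 ≤ η * H / 2) (hℓ : 1 ≤ d - c)
    (hqt : ∫ t in a..b, q t * tent c ((c + d) / 2) d t ≤ B * ((d - c) / 2) + k) :
    d - c ≤ 4 * H * M + 2 * H ^ 2 + k * H := by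
  have hab : a ≤ b := by linarith
  set m := (c + d) / 2 with hm
  have hcm : c < m := by linarith
  have hmd : m < d := by linarith
  have hγ : 0 ≤ g R := hg0 ▸ hmono hR
  have hC0 : 0 ≤ C := (abs_nonneg _).trans (hC 0)
  have hT := tent_mem_H10 hac hcm hmd hdb
  have hφ := H10.const_mul hT H
  have hsum := H10.add hab hu.1.1 hφ
  have hmin : action g q a b u ≤ action g q a b (fun t => u t + H * tent c m d t) :=
    hu.2 (show _ ∈ H10plus a b from ⟨hsum, fun t ht =>
      add_nonneg (hu.1.2 t ht) (mul_nonneg hH (tent_nonneg _ _ _ _))⟩)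
  have hexp := action_add_sub hab hg hq hu.1.1 hφ
  have hder : ∀ t, deriv (fun t => H * tent c m d t) t = H * deriv (tent c m d) t :=
    fun t => deriv_const_mul_field H
  simp only [hder] at hexp
  have e1 : ∫ t in a..b, deriv u t * (H * deriv (tent c m d) t) =
      H * ((u m - u c) / (m - c) - (u d - u m) / (d - m)) := by
    rw [← integral_deriv_mul_deriv_tent hac hcm hmd hdb hu.1.1.1,
      ← intervalIntegral.integral_const_mul]
    exact intervalIntegral.integral_congr fun t _ => by ring
  have e2 : ∫ t in a..b, (H * deriv (tent c m d) t) ^ 2 =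
      H ^ 2 * (1 / (m - c) + 1 / (d - m)) := by
    rw [← integral_deriv_tent_sq hac hcm hmd hdb, ← intervalIntegral.integral_const_mul]
    exact intervalIntegral.integral_congr fun t _ => by ring
  have e3 : ∫ t in a..b, q t * (H * tent c m d t) = H * ∫ t in a..b, q t * tent c m d t := by
    rw [← intervalIntegral.integral_const_mul]
    exact intervalIntegral.integral_congr fun t _ => by ring
  have hmc : m - c = (d - c) / 2 := by rw [hm]; ring
  have hdm : d - m = (d - c) / 2 := by rw [hm]; ring
  have hm0 : ∀ t ∈ Icc c d, 0 ≤ u t := fun t ht => hu.1.2 t ⟨hac.trans ht.1, ht.2.trans hdb⟩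
  -- The numerators add up to at most `2 * M`, and each half of the tent has width at least 1/2.
  have hd1 : (u m - u c) / (m - c) - (u d - u m) / (d - m) ≤ 4 * M := by
    rw [hmc, hdm, ← sub_div, div_le_iff₀ (by linarith)]
    have h1 := hM m ⟨hcm.le, hmd.le⟩
    have h2 := hm0 m ⟨hcm.le, hmd.le⟩
    have h3 := hm0 c ⟨le_rfl, hcd.le⟩
    have h4 := hm0 d ⟨hcd.le, le_rfl⟩
    nlinarith
  have hd2 : 1 / (m - c) + 1 / (d - m) ≤ 4 := by
    rw [hmc, hdm, ← add_div, div_le_iff₀ (by linarith)]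
    linarith
  set D : ℝ → ℝ := fun t => primitiveG g (u t + H * tent c m d t) - primitiveG g (u t) with hD
  have cG := continuous_primitiveG hg
  have cD : ContinuousOn D (Icc a b) :=
    (cG.comp_continuousOn (H10.continuousOn hsum hab)).sub
      (cG.comp_continuousOn (H10.continuousOn hu.1.1 hab))
  have iD : ∀ x y, a ≤ x → x ≤ y → y ≤ b → IntervalIntegrable D volume x y := fun x y h1 h2 h3 =>
    intervalIntegrable_of_continuousOn_Icc h2 (cD.mono (Icc_subset_Icc h1 h3))
  have hDl : ∫ t in a..c, D t = 0 := by
    rw [intervalIntegral.integral_congr (g := fun _ => 0), intervalIntegral.integral_zero]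
    intro t ht
    rw [uIcc_of_le hac] at ht
    simp [hD, tent_of_le_left hcm ht.2]
  have hDr : ∫ t in d..b, D t = 0 := by
    rw [intervalIntegral.integral_congr (g := fun _ => 0), intervalIntegral.integral_zero]
    intro t ht
    rw [uIcc_of_le hdb] at ht
    simp [hD, tent_of_right_le hmd ht.1]
  have hDsplit : ∫ t in a..b, D t = ∫ t in c..d, D t := by
    rw [← intervalIntegral.integral_add_adjacent_intervals
      (iD a d le_rfl (hac.trans hcd.le) hdb) (iD d b (by linarith) hdb le_rfl),
      ← intervalIntegral.integral_add_adjacent_intervals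
      (iD a c le_rfl hac (by linarith)) (iD c d hac hcd.le hdb), hDl, hDr]
    ring
  -- The tangent of G at `R` bounds the new potential from below, with `G(R) ≥ 0` and `u ≥ 0`; the
  -- old one is at most `C * M`.
  have hpt : ∀ t ∈ Icc c d, g R * H * tent c m d t - (g R * R + C * M) ≤ D t := fun t ht => by
    have h1 := mul_sub_le_primitiveG_sub hg hmono R (u t + H * tent c m d t)
    have h2 := mul_sub_le_primitiveG_sub hg hmono 0 R
    have h3 := (le_abs_self _).trans (abs_primitiveG_sub_le hg hC 0 (u t))
    rw [hg0, zero_mul] at h2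
    rw [sub_zero, abs_of_nonneg (hm0 t ht)] at h3
    have h4 := mul_le_mul_of_nonneg_left (hM t ht) hC0
    have h5 := mul_nonneg hγ (hm0 t ht)
    have h6 : primitiveG g 0 = 0 := intervalIntegral.integral_same
    simp only [hD]
    linarith
  have hTc : ContinuousOn (tent c m d) (Icc a b) := H10.continuousOn hT hab
  have iT : IntervalIntegrable (fun t => g R * H * tent c m d t) volume c d :=
    (intervalIntegrable_of_continuousOn_Icc hcd.le
      (hTc.mono (Icc_subset_Icc hac hdb))).const_mul _
  have hDlow : g R * H * ((d - c) / 2) - (g R * R + C * M) * (d - c) ≤ ∫ t in c..d, D t := by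
    have h := intervalIntegral.integral_mono_on hcd.le
      (iT.sub (intervalIntegrable_const (c := g R * R + C * M)))
      (iD c d hac hcd.le hdb) hpt
    rw [intervalIntegral.integral_sub iT intervalIntegrable_const,
      intervalIntegral.integral_const_mul, integral_tent le_rfl hcm hmd le_rfl,
      intervalIntegral.integral_const, smul_eq_mul] at h
    linarith
  rw [e1, e2, e3, hDsplit] at hexp
  have f1 := mul_le_mul_of_nonneg_left hd1 hH
  have f2 := mul_le_mul_of_nonneg_left hd2 (sq_nonneg H)
  have f3 := mul_le_mul_of_nonneg_left hqt hH
  -- Together `f4` and `f5` show that the terms proportional to the length lower the action by at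
  -- least `d - c`; minimality then bounds `d - c` by the remaining costs.
  have f4 : 0 ≤ H * ((d - c) / 2) * (g R - (B + η)) := by
    apply mul_nonneg (mul_nonneg hH (by linarith)); linarith
  have f5 : 0 ≤ (d - c) * (η * H / 2 - (g R * R + C * M + 1)) := by
    apply mul_nonneg <;> linarith
  nlinarith

end Energy

section Positivity

variable {g q u : ℝ → ℝ} {a b : ℝ} {B C N R k η : ℝ}

/-- Minimizers are positive on long intervals. The constants enter only through bounds for `g`,
for `q`, and for the means of `q`. -/
lemma IsMinimizer.pos_of_long (hab : a < b)
    (hg : Continuous g) (hmono : Monotone g) (hg0 : g 0 = 0) (hC : ∀ s, |g s| ≤ C)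
    (hq : IntervalIntegrable q volume a b) (hN : ∀ᵐ t, |q t| ≤ N) (hN0 : 0 ≤ N)
    (hR : 0 < R) (hη : 0 < η) (hBη : B + η ≤ g R)
    (hmean : ∀ r s, r ≤ s → ∫ t in r..s, q t ≤ k + B * (s - r))
    (htent : ∀ x y z, a ≤ x → x < y → y < z → z ≤ b →
      ∫ t in a..b, q t * tent x y z t ≤ B * ((z - x) / 2) + k)
    {M H : ℝ} (hM : M = R + (R + 2 * N + k) ^ 2 / (2 * η)) (hH : 0 ≤ H)
    (hEH : g R * R + C * M + 1 ≤ η * H / 2)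
    (hlong : 2 * (1 + |4 * H * M + 2 * H ^ 2 + k * H|) < b - a)
    (hu : IsMinimizer g q a b u) : ∀ t ∈ Ioo a b, 0 < u t := by
  intro t₀ ht₀
  by_contra hneg
  have hzero : u t₀ = 0 := le_antisymm (not_lt.1 hneg) (hu.1.2 t₀ (Ioo_subset_Icc_self ht₀))
  have cu := H10.continuousOn hu.1.1 hab.le
  have cQ := continuousOn_forcePrimitive hab.le hg hq cu
  have ih := intervalIntegrable_force hab.le hg hq cu
  have isub : ∀ {f : ℝ → ℝ}, IntervalIntegrable f volume a b → ∀ {r s}, a ≤ r → r ≤ s → s ≤ b →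
      IntervalIntegrable f volume r s := fun hf r s h1 h2 h3 =>
    hf.mono_set (by rw [uIcc_of_le h2, uIcc_of_le hab.le]; exact Icc_subset_Icc h1 h3)
  have igu : IntervalIntegrable (fun t => g (u t)) volume a b :=
    intervalIntegrable_of_continuousOn_Icc hab.le (hg.comp_continuousOn cu)
  have hQsub : ∀ r s, a ≤ r → r ≤ s → s ≤ b →
      forcePrimitive g q u a s - forcePrimitive g q u a r =
        (∫ t in r..s, q t) - ∫ t in r..s, g (u t) := fun r s h1 h2 h3 => by
    rw [← intervalIntegral.integral_sub (isub hq h1 h2 h3) (isub igu h1 h2 h3)]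
    exact intervalIntegral.integral_interval_sub_left (isub ih le_rfl (h1.trans h2) h3)
      (isub ih le_rfl h1 (h2.trans h3))
  -- Only an upper bound on the force is needed, and `g (u t) ≥ 0`, so the bound of `q` alone
  -- suffices.
  have hQ₁ : ∀ r s, a ≤ r → r ≤ s → s ≤ b →
      forcePrimitive g q u a s - forcePrimitive g q u a r ≤ N * (s - r) := fun r s h1 h2 h3 => by
    rw [hQsub r s h1 h2 h3]
    have f1 : 0 ≤ ∫ t in r..s, g (u t) := intervalIntegral.integral_nonneg h2 fun t ht =>
      hg0 ▸ hmono (hu.1.2 t ⟨h1.trans ht.1, ht.2.trans h3⟩)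
    have f2 := integral_mono_ae_Icc (H := fun _ => N) h2 (isub hq h1 h2 h3) (by simp)
      (hN.mono fun t ht _ => (le_abs_self _).trans ht)
    rw [intervalIntegral.integral_const, smul_eq_mul] at f2
    linarith
  have hQ₂ : ∀ r s, a ≤ r → r ≤ s → s ≤ b → (∀ t ∈ Icc r s, R ≤ u t) →
      forcePrimitive g q u a s - forcePrimitive g q u a r ≤ k - η * (s - r) :=
    fun r s h1 h2 h3 h4 => by
    rw [hQsub r s h1 h2 h3]
    have f1 := intervalIntegral.integral_mono_on (f := fun _ => g R) h2 (by simp)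
      (isub igu h1 h2 h3) fun t ht => hmono (h4 t ht)
    rw [intervalIntegral.integral_const, smul_eq_mul] at f1
    have f2 := hmean r s h2
    nlinarith
  have hslope : ∀ x y z, a ≤ x → x < y → y < z → z ≤ b → _ := fun x y z h1 h2 h3 h4 =>
    hu.slope_le h1 h2 h3 h4 hg hmono hq
  have habs := le_abs_self (4 * H * M + 2 * H ^ 2 + k * H)
  have habs0 := abs_nonneg (4 * H * M + 2 * H ^ 2 + k * H)
  -- The zero leaves an interval of at least half the length on one side. There the a priori bound
  -- holds, and `hlong` contradicts the energy comparison.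
  rcases le_or_gt ((a + b) / 2) t₀ with h | h
  · have hle := le_of_zero_right ht₀.1.le ht₀.2 hη hR hN0 cu cQ hu.1.2 hzero hslope hQ₁ hQ₂
    rw [← hM] at hle
    have := hu.not_bounded_of_long le_rfl ht₀.1 ht₀.2.le hg hmono hg0 hC hq hle hR.le hBη hH hEH
      (by linarith) (htent _ _ _ le_rfl (by linarith [ht₀.1]) (by linarith [ht₀.1]) ht₀.2.le)
    linarith
  · have hle := le_of_zero_left ht₀.1 ht₀.2.le hη hR hN0 cu cQ hu.1.2 hzero hslope hQ₁ hQ₂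
    rw [← hM] at hle
    have := hu.not_bounded_of_long ht₀.1.le ht₀.2 le_rfl hg hmono hg0 hC hq hle hR.le hBη hH hEH
      (by linarith) (htent _ _ _ ht₀.1.le (by linarith [ht₀.2]) (by linarith [ht₀.2]) le_rfl)
    linarith

end Positivity

/-! ### Bounds for means of the forcing term from its decompositions. -/

section Decomposition

variable {q q₁ q₂ : ℝ → ℝ} {a b A ε K : ℝ}

lemma ae_abs_le_of_eLpNorm_top_le {f : ℝ → ℝ} {c : ENNReal} (hc : c ≠ ⊤)
    (hf : eLpNorm f ⊤ volume ≤ c) : ∀ᵐ t, |f t| ≤ c.toReal := by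
  rw [eLpNorm_exponent_top] at hf
  filter_upwards [ae_le_eLpNormEssSup (f := f) (μ := volume)] with t ht
  have h := ENNReal.toReal_mono hc (ht.trans hf)
  rwa [toReal_enorm, Real.norm_eq_abs] at h

lemma intervalIntegrable_of_ae_abs_le {f : ℝ → ℝ} {N : ℝ} (hf : AEStronglyMeasurable f volume)
    (hN : ∀ᵐ t, |f t| ≤ N) (a b : ℝ) : IntervalIntegrable f volume a b := by
  rw [intervalIntegrable_iff]
  exact Measure.integrableOn_of_bounded (by simp) hf (M := N) (ae_restrict_of_ae hN)

lemma IsDecomposition.ae_abs_sub_le (h : IsDecomposition q A ε q₁ q₂) (hε : 0 < ε) :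
    ∀ᵐ t, |q₁ t - A| ≤ ε / 2 := by
  have := ae_abs_le_of_eLpNorm_top_le ENNReal.ofReal_ne_top h.norm_fst.le
  rwa [ENNReal.toReal_ofReal (by linarith)] at this

lemma IsDecomposition.intervalIntegrable_fst (h : IsDecomposition q A ε q₁ q₂) (hε : 0 < ε)
    (a b : ℝ) : IntervalIntegrable q₁ volume a b := by
  refine intervalIntegrable_of_ae_abs_le (N := ε / 2 + |A|) h.measurable_fst ?_ a b
  filter_upwards [h.ae_abs_sub_le hε] with t ht
  have := abs_add_le (q₁ t - A) A
  rw [sub_add_cancel] at this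
  linarith

lemma abs_le_of_ae_abs_le {f : ℝ → ℝ} (hf : Continuous f) (h : ∀ᵐ t, |f t| ≤ K) (t : ℝ) :
    |f t| ≤ K := by
  have hd : Dense {t | |f t| ≤ K} := Measure.dense_of_ae h
  have hcl : IsClosed {t | |f t| ≤ K} := isClosed_le hf.abs continuous_const
  exact hcl.closure_subset (hd t)

lemma IsDecomposition.continuous_snd (h : IsDecomposition q A ε q₁ q₂)
    (hi : ∀ a b, IntervalIntegrable (fun t => q t - q₁ t) volume a b) : Continuous q₂ := by
  have e : q₂ = fun t => q₂ 0 + ∫ x in (0 : ℝ)..t, (q x - q₁ x) := by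
    funext t
    rw [← h.primitive 0 t]
    ring
  rw [e]
  exact continuous_const.add (intervalIntegral.continuous_primitive hi 0)

/-- The derivative part contributes only the increment of `q₂`, at most `2 * K` on an interval of
any length. -/
lemma IsDecomposition.integral_le (h : IsDecomposition q A ε q₁ q₂) (hε : 0 < ε)
    (hq : ∀ a b, IntervalIntegrable q volume a b) (hK : ∀ t, |q₂ t| ≤ K) {r s : ℝ} (hrs : r ≤ s) :
    ∫ t in r..s, q t ≤ 2 * K + (A + ε / 2) * (s - r) := by
  have i₁ := h.intervalIntegrable_fst hε r s
  have h1 := h.primitive r s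
  rw [intervalIntegral.integral_sub (hq r s) i₁] at h1
  have h2 := integral_mono_ae_Icc (H := fun _ => A + ε / 2) hrs i₁ (by simp)
    ((h.ae_abs_sub_le hε).mono fun t ht _ => by linarith [(le_abs_self _).trans ht])
  rw [intervalIntegral.integral_const, smul_eq_mul] at h2
  have h3 := abs_le.1 (hK r)
  have h4 := abs_le.1 (hK s)
  linarith [h3.1, h4.2]

/-- Against a tent the derivative part becomes a difference of two means of `q₂`, again at most `2 *
K`. -/
lemma IsDecomposition.integral_mul_tent_le (h : IsDecomposition q A ε q₁ q₂) (hε : 0 < ε)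
    (hq : ∀ a b, IntervalIntegrable q volume a b) (hK : ∀ t, |q₂ t| ≤ K) {x y z : ℝ}
    (hax : a ≤ x) (hxy : x < y) (hyz : y < z) (hzb : z ≤ b) :
    ∫ t in a..b, q t * tent x y z t ≤ (A + ε / 2) * ((z - x) / 2) + 2 * K := by
  have hab : a ≤ b := by linarith
  have hT := H10.continuousOn (tent_mem_H10 hax hxy hyz hzb) hab
  have i₁ := h.intervalIntegrable_fst hε
  have j₁ := intervalIntegrable_mul_continuousOn hab (i₁ a b) hT
  have j := intervalIntegrable_mul_continuousOn hab ((hq a b).sub (i₁ a b)) hT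
  have e : ∫ t in a..b, q t * tent x y z t =
      (∫ t in a..b, (q t - q₁ t) * tent x y z t) + ∫ t in a..b, q₁ t * tent x y z t := by
    rw [← intervalIntegral.integral_add j j₁]
    exact intervalIntegral.integral_congr fun t _ => by ring
  have h1 : ∫ t in a..b, q₁ t * tent x y z t ≤ ∫ t in a..b, (A + ε / 2) * tent x y z t :=
    integral_mono_ae_Icc hab j₁ ((intervalIntegrable_of_continuousOn_Icc hab hT).const_mul _)
      ((h.ae_abs_sub_le hε).mono fun t ht _ =>
        mul_le_mul_of_nonneg_right (by linarith [(le_abs_self _).trans ht])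
          (tent_nonneg _ _ _ _))
  rw [intervalIntegral.integral_const_mul, integral_tent hax hxy hyz hzb] at h1
  have hmean : ∀ c d, c < d → |(∫ t in c..d, q₂ t) / (d - c)| ≤ K := fun c d hcd => by
    have hd : 0 < d - c := sub_pos.2 hcd
    have := intervalIntegral.norm_integral_le_of_norm_le_const (a := c) (b := d) (f := q₂)
      fun t _ => hK t
    rw [Real.norm_eq_abs, abs_of_pos hd] at this
    rwa [abs_div, abs_of_pos hd, div_le_iff₀ hd]
  rw [e, integral_mul_tent hax hxy hyz hzb ((hq a b).sub (i₁ a b)) fun t _ => by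
    rw [← h.primitive a t]; ring]
  have h2 := abs_le.1 (hmean y z hyz)
  have h3 := abs_le.1 (hmean x y hxy)
  linarith [h2.2, h3.1]

end Decomposition

/-! ### The direct method and compactness of the Volterra operator. -/

section DirectMethod

/-- The direct method: a quadratic functional perturbed by a Lipschitz function of a compact image
has a minimizer on each closed convex set. -/
lemma exists_isMinOn_of_compact {H E : Type*} [NormedAddCommGroup H] [InnerProductSpace ℝ H]
    [CompleteSpace H] [NormedAddCommGroup E] [NormedSpace ℝ E] (T : H →L[ℝ] E)
    (hT : ∀ r : ℝ, IsCompact (closure (T '' Metric.closedBall 0 r))) (F : E → ℝ) {κ : ℝ}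
    (hκ : 0 ≤ κ) (hF : ∀ x y, |F x - F y| ≤ κ * ‖x - y‖) {K : Set H} (hK : IsClosed K)
    (hconv : Convex ℝ K) (hne : K.Nonempty) :
    ∃ f ∈ K, ∀ f' ∈ K, (1 / 2) * ‖f‖ ^ 2 + F (T f) ≤ (1 / 2) * ‖f'‖ ^ 2 + F (T f') := by
  set J : H → ℝ := fun f => (1 / 2) * ‖f‖ ^ 2 + F (T f) with hJ
  have hFc : Continuous F := by
    refine (LipschitzWith.of_dist_le_mul (K := ⟨κ, hκ⟩) fun x y => ?_).continuous
    rw [Real.dist_eq, dist_eq_norm]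
    exact hF x y
  have hJc : Continuous J := by
    have := hFc.comp T.continuous
    exact (continuous_const.mul (continuous_norm.pow 2)).add this
  have hlow : ∀ f, (1 / 2) * ‖f‖ ^ 2 - κ * ‖T‖ * ‖f‖ + F 0 ≤ J f := fun f => by
    have h1 := (abs_le.1 (hF (T f) 0)).1
    have h2 := mul_le_mul_of_nonneg_left (T.le_opNorm f) hκ
    rw [sub_zero] at h1
    simp only [hJ]
    linarith
  have hbdd : BddBelow (J '' K) := by
    refine ⟨F 0 - (κ * ‖T‖) ^ 2 / 2, ?_⟩
    rintro _ ⟨f, -, rfl⟩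
    nlinarith [hlow f, sq_nonneg (‖f‖ - κ * ‖T‖)]
  set m := sInf (J '' K) with hm
  have hmle : ∀ f ∈ K, m ≤ J f := fun f hf => csInf_le hbdd ⟨f, hf, rfl⟩
  have hseq : ∀ n : ℕ, ∃ f ∈ K, J f < m + 1 / ((n : ℝ) + 1) := fun n => by
    obtain ⟨_, ⟨f, hf, rfl⟩, h⟩ := exists_lt_of_csInf_lt (hne.image J)
      (lt_add_of_pos_right m (Nat.one_div_pos_of_nat (α := ℝ) (n := n)))
    exact ⟨f, hf, h⟩
  choose f hfK hfJ using hseq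
  have hlim0 : Tendsto (fun n : ℕ => 1 / ((n : ℝ) + 1)) atTop (𝓝 0) :=
    tendsto_one_div_add_atTop_nhds_zero_nat
  -- Any radius containing the sublevel set `J ≤ m + 1` would do; this one comes from completing the
  -- square in `hlow`.
  set r := 4 * (m + 1 - F 0 + (κ * ‖T‖) ^ 2) + 1 with hr
  have hball : ∀ n, f n ∈ Metric.closedBall (0 : H) r := fun n => by
    rw [mem_closedBall_zero_iff]
    have h1 : 1 / ((n : ℝ) + 1) ≤ 1 := by
      rw [div_le_one (by positivity)]
      linarith [Nat.cast_nonneg (α := ℝ) n]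
    have h2 := hlow (f n)
    have h3 := hfJ n
    nlinarith [sq_nonneg (‖f n‖ - 2 * (κ * ‖T‖)), sq_nonneg (‖f n‖ - 1)]
  obtain ⟨e, -, φ, hφ, he⟩ := (hT r).tendsto_subseq (x := fun n => T (f n)) fun n =>
    subset_closure ⟨f n, hball n, rfl⟩
  have hlimφ := hlim0.comp hφ.tendsto_atTop
  -- Comparing with the midpoint, the parallelogram law controls `‖x - y‖` by the excess of the
  -- action and by `‖T x - T y‖`. Hence a minimizing sequence whose images converge is itself
  -- Cauchy, and no weak convergence is needed.
  have hpar : ∀ x ∈ K, ∀ y ∈ K, (1 / 4) * ‖x - y‖ ^ 2 ≤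
      (J x - m) + (J y - m) + κ * ‖T x - T y‖ := fun x hx y hy => by
    set z := (1 / 2 : ℝ) • x + (1 / 2 : ℝ) • y with hz
    have hzK : z ∈ K := hconv hx hy (by norm_num) (by norm_num) (by norm_num)
    have h1 := hmle z hzK
    have hzn : ‖z‖ = (1 / 2) * ‖x + y‖ := by
      rw [hz, ← smul_add, norm_smul]
      norm_num
    have h2 := parallelogram_law_with_norm ℝ x y
    have hx' : T x - T z = (1 / 2 : ℝ) • (T x - T y) := by
      rw [hz, map_add, map_smul, map_smul]
      module
    have hy' : T y - T z = (1 / 2 : ℝ) • (T y - T x) := by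
      rw [hz, map_add, map_smul, map_smul]
      module
    have h3 := (abs_le.1 (hF (T x) (T z))).1
    have h4 := (abs_le.1 (hF (T y) (T z))).1
    rw [hx', norm_smul] at h3
    rw [hy', norm_smul, norm_sub_rev] at h4
    norm_num at h3 h4
    simp only [hJ] at h1 ⊢
    rw [hzn] at h1
    nlinarith
  have hcau : CauchySeq (fun n => f (φ n)) := by
    rw [Metric.cauchySeq_iff]
    intro ε hε
    have hTc := Metric.cauchySeq_iff.1 he.cauchySeq (ε ^ 2 / (16 * (κ + 1))) (by positivity)
    obtain ⟨N₁, hN₁⟩ := hTc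
    obtain ⟨N₂, hN₂⟩ := eventually_atTop.1 (hlimφ.eventually_lt_const
      (show (0 : ℝ) < ε ^ 2 / 16 by positivity))
    refine ⟨max N₁ N₂, fun i hi j hj => ?_⟩
    have h1 := hN₁ i ((le_max_left _ _).trans hi) j ((le_max_left _ _).trans hj)
    have h2 := hN₂ i ((le_max_right _ _).trans hi)
    have h3 := hN₂ j ((le_max_right _ _).trans hj)
    have h4 := hpar _ (hfK (φ i)) _ (hfK (φ j))
    have h5 := hfJ (φ i)
    have h6 := hfJ (φ j)
    simp only [Function.comp_apply] at h1 h2 h3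
    rw [dist_eq_norm] at h1 ⊢
    have h7 : κ * ‖T (f (φ i)) - T (f (φ j))‖ ≤ ε ^ 2 / 16 := by
      calc κ * ‖T (f (φ i)) - T (f (φ j))‖ ≤ (κ + 1) * (ε ^ 2 / (16 * (κ + 1))) :=
            mul_le_mul (by linarith) h1.le (norm_nonneg _) (by linarith)
        _ = ε ^ 2 / 16 := by field_simp
    have h8 : ‖f (φ i) - f (φ j)‖ ^ 2 < ε ^ 2 := by linarith [pow_pos hε 2]
    exact lt_of_pow_lt_pow_left₀ 2 hε.le h8
  obtain ⟨f₀, hf₀⟩ := cauchySeq_tendsto_of_complete hcau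
  have hf₀K : f₀ ∈ K := hK.mem_of_tendsto hf₀ (Eventually.of_forall fun n => hfK _)
  refine ⟨f₀, hf₀K, fun f' hf' => ?_⟩
  refine le_trans ?_ (hmle f' hf')
  have hl : Tendsto (fun n => J (f (φ n))) atTop (𝓝 (J f₀)) := (hJc.tendsto f₀).comp hf₀
  have hr' : Tendsto (fun n => m + 1 / (((φ n : ℕ) : ℝ) + 1)) atTop (𝓝 (m + 0)) :=
    tendsto_const_nhds.add hlimφ
  rw [add_zero] at hr'
  exact le_of_tendsto_of_tendsto' hl hr' fun n => (hfJ _).le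

end DirectMethod

section Volterra

variable {a b : ℝ}

/-- The space of square integrable functions on `(a, b]`. -/
abbrev L2 (a b : ℝ) := Lp ℝ 2 (volume.restrict (Ioc a b))

lemma L2.intervalIntegrable (f : L2 a b) {s t : ℝ} (has : a ≤ s) (hst : s ≤ t) (htb : t ≤ b) :
    IntervalIntegrable f volume s t := by
  rw [intervalIntegrable_iff_integrableOn_Ioc_of_le hst]
  have h : Integrable f (volume.restrict (Ioc a b)) := (Lp.memLp f).integrable (by norm_num)
  exact IntegrableOn.mono_set h (Ioc_subset_Ioc has htb)

/-- Cauchy–Schwarz against the indicator of `(s, t]`. The resulting Hölder modulus of exponent 1/2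
makes the primitives equicontinuous. -/
lemma L2.abs_integral_le (f : L2 a b) {s t : ℝ} (has : a ≤ s) (hst : s ≤ t) (htb : t ≤ b) :
    |∫ r in s..t, f r| ≤ √(t - s) * ‖f‖ := by
  have hfin : (volume.restrict (Ioc a b)) (Ioc s t) ≠ ⊤ := measure_ne_top _ _
  have h := L2.inner_indicatorConstLp_one (𝕜 := ℝ) measurableSet_Ioc hfin f
  have hsub : Ioc s t ∩ Ioc a b = Ioc s t := inter_eq_left.2 (Ioc_subset_Ioc has htb)
  rw [Measure.restrict_restrict measurableSet_Ioc, hsub,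
    ← intervalIntegral.integral_of_le hst] at h
  rw [← h]
  refine (abs_real_inner_le_norm _ _).trans (mul_le_mul_of_nonneg_right ?_ (norm_nonneg _))
  rw [norm_indicatorConstLp (by norm_num) (by norm_num), Measure.real,
    Measure.restrict_apply measurableSet_Ioc, hsub, Real.volume_Ioc,
    ENNReal.toReal_ofReal (sub_nonneg.2 hst), Real.sqrt_eq_rpow]
  norm_num

lemma L2.abs_integral_sub_le (f : L2 a b) {s t : ℝ} (hs : s ∈ Icc a b) (ht : t ∈ Icc a b) :
    |(∫ r in a..t, f r) - ∫ r in a..s, f r| ≤ √|t - s| * ‖f‖ := by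
  have key : ∀ s ∈ Icc a b, ∀ t ∈ Icc a b, s ≤ t →
      |(∫ r in a..t, f r) - ∫ r in a..s, f r| ≤ √|t - s| * ‖f‖ := fun s hs t ht hst => by
    rw [intervalIntegral.integral_interval_sub_left (L2.intervalIntegrable f le_rfl ht.1 ht.2)
      (L2.intervalIntegrable f le_rfl hs.1 hs.2), abs_of_nonneg (sub_nonneg.2 hst)]
    exact L2.abs_integral_le f hs.1 hst ht.2
  rcases le_total s t with h | h
  · exact key s hs t ht h
  · rw [abs_sub_comm, abs_sub_comm t s]
    exact key t ht s hs h

/-- The primitive of a square integrable function, as a continuous function. -/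
def L2.primitive (f : L2 a b) : BoundedContinuousFunction (Icc a b) ℝ :=
  BoundedContinuousFunction.mkOfCompact
    ⟨fun t => ∫ r in a..(t : ℝ), f r, by
      refine continuous_iff_continuousAt.2 fun s => tendsto_iff_norm_sub_tendsto_zero.2 ?_
      have hl : Tendsto (fun t : Icc a b => √|(t : ℝ) - s| * ‖f‖) (𝓝 s) (𝓝 0) := by
        have hc : Continuous fun t : Icc a b => √|(t : ℝ) - s| * ‖f‖ := by fun_prop
        simpa using hc.tendsto s
      exact squeeze_zero (fun _ => norm_nonneg _)
        (fun t => L2.abs_integral_sub_le f s.2 t.2) hl⟩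

lemma L2.primitive_apply (f : L2 a b) (t : Icc a b) :
    L2.primitive f t = ∫ r in a..(t : ℝ), f r := rfl

lemma integral_congr_of_ae_restrict {f h : ℝ → ℝ} {t : ℝ} (hat : a ≤ t) (htb : t ≤ b)
    (hfh : f =ᵐ[volume.restrict (Ioc a b)] h) : ∫ r in a..t, f r = ∫ r in a..t, h r := by
  refine intervalIntegral.integral_congr_ae_restrict ?_
  rw [uIoc_of_le hat]
  exact ae_restrict_of_ae_restrict_of_subset (Ioc_subset_Ioc_right htb) hfh

/-- The Volterra operator. -/
def volterra (a b : ℝ) : L2 a b →L[ℝ] BoundedContinuousFunction (Icc a b) ℝ :=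
  LinearMap.mkContinuous
    { toFun := L2.primitive
      map_add' := fun f h => by
        ext t
        rw [BoundedContinuousFunction.add_apply, L2.primitive_apply, L2.primitive_apply,
          L2.primitive_apply, ← intervalIntegral.integral_add
            (L2.intervalIntegrable f le_rfl t.2.1 t.2.2)
            (L2.intervalIntegrable h le_rfl t.2.1 t.2.2)]
        exact integral_congr_of_ae_restrict t.2.1 t.2.2 (Lp.coeFn_add f h)
      map_smul' := fun c f => by
        ext t
        rw [BoundedContinuousFunction.smul_apply, L2.primitive_apply, L2.primitive_apply,
          RingHom.id_apply, smul_eq_mul, ← intervalIntegral.integral_const_mul]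
        exact integral_congr_of_ae_restrict t.2.1 t.2.2 (Lp.coeFn_smul c f) }
    (√(b - a)) fun f => by
      refine (BoundedContinuousFunction.norm_le (by positivity)).2 fun t => ?_
      refine (L2.abs_integral_le f le_rfl t.2.1 t.2.2).trans ?_
      exact mul_le_mul_of_nonneg_right (Real.sqrt_le_sqrt (by linarith [t.2.2])) (norm_nonneg _)

lemma volterra_apply (f : L2 a b) (t : Icc a b) :
    volterra a b f t = ∫ r in a..(t : ℝ), f r := rfl

/-- Arzelà–Ascoli: primitives of a bounded set in L² are uniformly bounded and share the modulus `√d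
* r`. -/
lemma isCompact_closure_volterra_image (a b r : ℝ) :
    IsCompact (closure (volterra a b '' Metric.closedBall 0 r)) := by
  refine BoundedContinuousFunction.arzela_ascoli (Metric.closedBall 0 (‖volterra a b‖ * r))
    (isCompact_closedBall _ _) _ ?_ ?_
  · rintro _ t ⟨f, hf, rfl⟩
    rw [mem_closedBall_zero_iff] at hf ⊢
    exact ((BoundedContinuousFunction.norm_coe_le_norm _ t).trans
      ((volterra a b).le_opNorm f)).trans (mul_le_mul_of_nonneg_left hf (norm_nonneg _))
  · refine Metric.equicontinuous_of_continuity_modulus (fun d => √d * r) ?_ _ ?_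
    · have hc : Continuous fun d : ℝ => √d * r := by fun_prop
      simpa using hc.tendsto 0
    · rintro s t ⟨_, f, hf, rfl⟩
      rw [mem_closedBall_zero_iff] at hf
      have h := L2.abs_integral_sub_le f t.2 s.2
      exact h.trans (mul_le_mul_of_nonneg_left hf (Real.sqrt_nonneg _))

end Volterra

/-! ### Existence of minimizers. -/

section Existence

variable {g q : ℝ → ℝ} {a b C N : ℝ}

/-- The part of the action without derivatives, on continuous functions on `[a, b]`. -/
def potential (g q : ℝ → ℝ) (hab : a ≤ b) (e : BoundedContinuousFunction (Icc a b) ℝ) : ℝ :=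
  ∫ t in a..b, (-primitiveG g (e (projIcc a b hab t)) + q t * e (projIcc a b hab t))

lemma abs_potential_sub_le (hab : a ≤ b) (hg : Continuous g) (hC : ∀ s, |g s| ≤ C)
    (hq : IntervalIntegrable q volume a b) (hN : ∀ᵐ t, |q t| ≤ N)
    (x y : BoundedContinuousFunction (Icc a b) ℝ) :
    |potential g q hab x - potential g q hab y| ≤ (C + N) * (b - a) * ‖x - y‖ := by
  have hce : ∀ e : BoundedContinuousFunction (Icc a b) ℝ,
      Continuous fun t => e (projIcc a b hab t) := fun e => e.continuous.comp continuous_projIcc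
  have hi : ∀ e : BoundedContinuousFunction (Icc a b) ℝ, IntervalIntegrable
      (fun t => -primitiveG g (e (projIcc a b hab t)) + q t * e (projIcc a b hab t))
      volume a b := fun e =>
    (((continuous_primitiveG hg).comp (hce e)).neg.intervalIntegrable _ _).add
      (intervalIntegrable_mul_continuousOn hab hq (hce e).continuousOn)
  rw [potential, potential, ← intervalIntegral.integral_sub (hi x) (hi y), ← Real.norm_eq_abs]
  have h : ∀ᵐ t, t ∈ uIoc a b →
      ‖(-primitiveG g (x (projIcc a b hab t)) + q t * x (projIcc a b hab t)) -
        (-primitiveG g (y (projIcc a b hab t)) + q t * y (projIcc a b hab t))‖ ≤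
        (C + N) * ‖x - y‖ := by
    filter_upwards [hN] with t ht _
    set w := projIcc a b hab t
    have h1 := abs_primitiveG_sub_le hg hC (x w) (y w)
    have h2 : |x w - y w| ≤ ‖x - y‖ := (x - y).norm_coe_le_norm w
    have hC0 : 0 ≤ C := (abs_nonneg _).trans (hC 0)
    have e : -primitiveG g (x w) + q t * x w - (-primitiveG g (y w) + q t * y w) =
        (primitiveG g (y w) - primitiveG g (x w)) + q t * (x w - y w) := by ring
    rw [e, Real.norm_eq_abs]
    refine (abs_add_le _ _).trans ?_
    rw [abs_mul, add_mul]
    rw [abs_sub_comm (y w)] at h1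
    exact add_le_add (h1.trans (mul_le_mul_of_nonneg_left h2 hC0))
      (mul_le_mul ht h2 (abs_nonneg _) ((abs_nonneg _).trans ht))
  refine (intervalIntegral.norm_integral_le_of_norm_le_const_ae h).trans (le_of_eq ?_)
  rw [abs_of_nonneg (sub_nonneg.2 hab)]
  ring

/-- The action in terms of the derivative. -/
lemma action_eq_of_derivative {u : ℝ → ℝ} (hab : a ≤ b) (hg : Continuous g)
    (hq : IntervalIntegrable q volume a b) (f : L2 a b) (hu : u ∈ H10 a b)
    (hd : ∀ᵐ t, t ∈ Icc a b → deriv u t = f t)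
    (huf : ∀ t ∈ Icc a b, u t = ∫ r in a..t, f r) :
    action g q a b u = (1 / 2) * ‖f‖ ^ 2 + potential g q hab (volterra a b f) := by
  have hv : ∀ t ∈ Icc a b, volterra a b f (projIcc a b hab t) = u t := fun t ht => by
    rw [projIcc_of_mem hab ht, volterra_apply, huf t ht]
  have cu := H10.continuousOn hu hab
  have i1 := (H10.intervalIntegrable_deriv_sq hab hu).const_mul (1 / 2)
  have i2 : IntervalIntegrable (fun t => -primitiveG g (u t) + q t * u t) volume a b :=
    (intervalIntegrable_of_continuousOn_Icc hab
      ((continuous_primitiveG hg).comp_continuousOn cu).neg).add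
      (intervalIntegrable_mul_continuousOn hab hq cu)
  have e1 : ‖f‖ ^ 2 = ∫ t in a..b, deriv u t ^ 2 := by
    rw [← real_inner_self_eq_norm_sq, L2.inner_def, ← intervalIntegral.integral_of_le hab]
    refine integral_congr_ae_Icc hab ?_
    filter_upwards [hd] with t ht hm
    rw [ht hm, real_inner_self_eq_norm_sq, Real.norm_eq_abs, sq_abs]
  have e2 : potential g q hab (volterra a b f) =
      ∫ t in a..b, (-primitiveG g (u t) + q t * u t) :=
    intervalIntegral.integral_congr fun t ht => by
      rw [uIcc_of_le hab] at ht
      simp only [hv t ht]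
  rw [e1, e2, ← intervalIntegral.integral_const_mul, ← intervalIntegral.integral_add i1 i2, action]
  exact intervalIntegral.integral_congr fun t _ => by ring

/-- Existence of minimizers. -/
theorem exists_isMinimizer (hab : a ≤ b) (hg : Continuous g) (hC : ∀ s, |g s| ≤ C)
    (hq : IntervalIntegrable q volume a b) (hN : ∀ᵐ t, |q t| ≤ N) (hN0 : 0 ≤ N) :
    ∃ u, IsMinimizer g q a b u := by
  have hC0 : 0 ≤ C := (abs_nonneg _).trans (hC 0)
  -- The derivatives of functions in `H10plus a b`. Vanishing at `a` is built into the primitive, so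
  -- only the condition at `b` is imposed.
  set K : Set (L2 a b) := {f | (∀ t, 0 ≤ volterra a b f t) ∧
    volterra a b f ⟨b, right_mem_Icc.2 hab⟩ = 0} with hKdef
  have hev : ∀ t : Icc a b, Continuous fun f : L2 a b => volterra a b f t := fun t =>
    (continuous_eval_const t).comp (volterra a b).continuous
  have hK : IsClosed K := by
    have e : K = (⋂ t, {f | 0 ≤ volterra a b f t}) ∩
        {f | volterra a b f ⟨b, right_mem_Icc.2 hab⟩ = 0} := by
      ext f
      simp [hKdef]
    rw [e]
    exact (isClosed_iInter fun t => isClosed_le continuous_const (hev t)).inter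
      (isClosed_eq (hev _) continuous_const)
  have hconv : Convex ℝ K := by
    intro x hx y hy α β hα hβ _
    have e : ∀ t, volterra a b (α • x + β • y) t =
        α * volterra a b x t + β * volterra a b y t := fun t => by
      rw [map_add, map_smul, map_smul]
      rfl
    refine ⟨fun t => ?_, ?_⟩
    · rw [e]
      exact add_nonneg (mul_nonneg hα (hx.1 t)) (mul_nonneg hβ (hy.1 t))
    · rw [e, hx.2, hy.2]
      ring
  have hne : K.Nonempty := ⟨0, fun t => by rw [map_zero]; rfl, by rw [map_zero]; rfl⟩
  obtain ⟨f, hfK, hfmin⟩ := exists_isMinOn_of_compact (volterra a b)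
    (isCompact_closure_volterra_image a b) (potential g q hab)
    (mul_nonneg (add_nonneg hC0 hN0) (sub_nonneg.2 hab))
    (abs_potential_sub_le hab hg hC hq hN) hK hconv hne
  have hfi := L2.intervalIntegrable f le_rfl hab le_rfl
  set u : ℝ → ℝ := fun t => ∫ r in a..t, f r with hu
  have hd : ∀ᵐ t, t ∈ Icc a b → deriv u t = f t := by
    filter_upwards [hfi.ae_hasDerivAt_integral] with t ht hm
    rw [uIcc_of_le hab] at ht
    exact (ht hm a (left_mem_Icc.2 hab)).deriv
  have huH : u ∈ H10 a b := by
    refine ⟨hfi.absolutelyContinuousOnInterval_intervalIntegral (by simp), ?_, by simp [hu],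
      hfK.2⟩
    rw [restrict_Ioo_eq_restrict_Ioc]
    refine (Lp.memLp f).ae_eq ?_
    refine (ae_restrict_iff' measurableSet_Ioc).2 ?_
    filter_upwards [hd] with t ht hm using (ht (Ioc_subset_Icc_self hm)).symm
  refine ⟨u, ⟨huH, fun t ht => hfK.1 ⟨t, ht⟩⟩, fun z hz => ?_⟩
  have hzm := H10.memLp_deriv hz.1
  set fz : L2 a b := hzm.toLp (deriv z) with hfz
  have hzae : ∀ᵐ t, t ∈ Icc a b → deriv z t = fz t := by
    have h := (ae_restrict_iff' measurableSet_Ioc).1 hzm.coeFn_toLp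
    filter_upwards [h, ae_mem_Ioo_of_mem_Icc a b] with t ht h1 hm
    exact (ht (Ioo_subset_Ioc_self (h1 hm))).symm
  have hzint : ∀ t ∈ Icc a b, z t = ∫ r in a..t, fz r := fun t ht => by
    rw [integral_congr_of_ae_restrict ht.1 ht.2 hzm.coeFn_toLp,
      (hz.1.1.mono (by
        rw [uIcc_of_le ht.1, uIcc_of_le hab]
        exact Icc_subset_Icc_right ht.2)).integral_deriv_eq_sub, hz.1.2.2.1, sub_zero]
  have hfzK : fz ∈ K := by
    refine ⟨fun t => ?_, ?_⟩
    · rw [volterra_apply, ← hzint t t.2]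
      exact hz.2 t t.2
    · rw [volterra_apply, ← hzint b (right_mem_Icc.2 hab)]
      exact hz.1.2.2.2
  change action g q a b u ≤ action g q a b z
  rw [action_eq_of_derivative hab hg hq f huH hd fun t _ => rfl,
    action_eq_of_derivative hab hg hq fz hz.1 hzae hzint]
  exact hfmin fz hfzK

end Existence

end BVP

end

/-! ### Choice of the uniform constants and conclusion. -/

theorem proposition4 (g : ℝ → ℝ) (gm gp : ℝ)
    (hg : BVP.AdmissibleNonlinearity g)
    (hgm : Tendsto g atBot (𝓝 gm)) (hgp : Tendsto g atTop (𝓝 gp))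
    (p : ℝ → ℝ) (A : ℝ) (hp : BVP.AdmissibleForcing gm gp p A) :
    -- existence, positivity and uniqueness on large intervals, uniformly in the class `𝒫`
    (∀ p₁ p₂ : ℝ → ℝ → ℝ,
      (∀ ε ∈ Ioo (0 : ℝ) 1, BVP.IsDecomposition p A ε (p₁ ε) (p₂ ε)) →
      ∀ L₀ > 0, ∃ L ≥ L₀, ∀ a b : ℝ, L ≤ b - a → ∀ q ∈ BVP.classP p A p₂,
        (∃ u, BVP.IsMinimizer g q a b u) ∧
        (∀ u, BVP.IsMinimizer g q a b u →
          (∀ t ∈ Ioo a b, 0 < u t) ∧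
          BVP.SolvesDirichlet g q a b u ∧
          (ContinuousOn q (Ioo a b) → BVP.SolvesDirichletClassically g q a b u)) ∧
        (∀ u v, BVP.IsMinimizer g q a b u → BVP.IsMinimizer g q a b v →
          EqOn u v (Icc a b))) ∧
    -- on an arbitrary interval, two positive `C²` minimizers coincide
    (∀ a b : ℝ, a < b → ∀ u v : ℝ → ℝ,
      ContDiffOn ℝ 2 u (Ioo a b) → ContDiffOn ℝ 2 v (Ioo a b) →
      (∀ t ∈ Ioo a b, 0 < u t) → (∀ t ∈ Ioo a b, 0 < v t) →
      BVP.IsMinimizer g p a b u → BVP.IsMinimizer g p a b v →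
      EqOn u v (Icc a b)) := by
  obtain ⟨C, hC⟩ := hg.bounded
  have hgc : Continuous g := hg.contDiff.continuous
  have hmono := hg.strictMono.monotone
  refine ⟨?_, ?_⟩
  · intro p₁ p₂ hdec L₀ _
    -- One level suffices: `ε < 1` as the class requires, and `A + ε < gp`, so that `g` exceeds `A +
    -- ε` at some `R > 0`. Half of `ε` covers the oscillation of `q₁`; the other half is the drift
    -- `η`.
    set ε := min (1 / 2) ((gp - A) / 2) with hε
    have hε0 : 0 < ε := lt_min (by norm_num) (by linarith [hp.upper])
    have hε1 : ε < 1 := (min_le_left _ _).trans_lt (by norm_num)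
    have hεg : A + ε < gp := by
      have := min_le_right (1 / 2) ((gp - A) / 2)
      linarith [hp.upper]
    obtain ⟨R, hRg, hR⟩ := ((hgp.eventually (lt_mem_nhds hεg)).and (eventually_gt_atTop 0)).exists
    obtain ⟨Cp, hCp⟩ := hp.bounded
    have hptop : eLpNorm p ⊤ volume + 1 ≠ ⊤ := ENNReal.add_ne_top.2
      ⟨(memLp_top_of_bound hp.continuous.aestronglyMeasurable Cp
        (Eventually.of_forall hCp)).eLpNorm_ne_top, ENNReal.one_ne_top⟩
    have hp₂top : eLpNorm (p₂ ε) ⊤ volume + 1 ≠ ⊤ := ENNReal.add_ne_top.2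
      ⟨(hdec ε ⟨hε0, hε1⟩).memLp_snd.eLpNorm_ne_top, ENNReal.one_ne_top⟩
    set N := (eLpNorm p ⊤ volume + 1).toReal
    have hN0 : 0 ≤ N := ENNReal.toReal_nonneg
    set K := (eLpNorm (p₂ ε) ⊤ volume + 1).toReal
    set M := R + (R + 2 * N + 2 * K) ^ 2 / (2 * (ε / 2)) with hM
    -- The height solves the requirement `hEH`; the absolute value makes `H ≥ 0` immediate.
    set H := 2 * (|g R * R + C * M| + 1) / (ε / 2) with hH
    have hH0 : 0 ≤ H := by positivity
    have hEH : g R * R + C * M + 1 ≤ ε / 2 * H / 2 := by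
      have e : ε / 2 * H / 2 = |g R * R + C * M| + 1 := by
        rw [hH]
        field_simp
      rw [e]
      linarith [le_abs_self (g R * R + C * M)]
    -- The final `+ 1` turns `L ≤ b - a` into the strict inequality `hlong`. No constant here
    -- depends on `a`, `b` or `q`.
    refine ⟨max L₀ (2 * (1 + |4 * H * M + 2 * H ^ 2 + 2 * K * H|) + 1), le_max_left _ _, ?_⟩
    intro a b hL q hq
    have hL' := (le_max_right _ _).trans hL
    have hab : a < b := by
      linarith [abs_nonneg (4 * H * M + 2 * H ^ 2 + 2 * K * H)]
    obtain ⟨hqm, hqn, -, hqd⟩ := hq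
    obtain ⟨q₁, q₂, hd, hq₂⟩ := hqd ε ⟨hε0, hε1⟩
    have hqN : ∀ᵐ t, |q t| ≤ N := BVP.ae_abs_le_of_eLpNorm_top_le hptop hqn.le
    have hqi := BVP.intervalIntegrable_of_ae_abs_le hqm.1 hqN
    have hq₂K : ∀ t, |q₂ t| ≤ K :=
      BVP.abs_le_of_ae_abs_le
        (hd.continuous_snd fun r s => (hqi r s).sub (hd.intervalIntegrable_fst hε0 r s))
        (BVP.ae_abs_le_of_eLpNorm_top_le hp₂top hq₂.le)
    have hpos : ∀ u, BVP.IsMinimizer g q a b u → ∀ t ∈ Ioo a b, 0 < u t := fun u hu =>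
      hu.pos_of_long (B := A + ε / 2) (k := 2 * K) (η := ε / 2) hab hgc hmono hg.zero hC
        (hqi a b) hqN hN0 hR (by linarith) (by linarith)
        (fun r s hrs => hd.integral_le hε0 hqi hq₂K hrs)
        (fun x y z h1 h2 h3 h4 => hd.integral_mul_tent_le hε0 hqi hq₂K h1 h2 h3 h4)
        hM hH0 hEH (by linarith)
    refine ⟨BVP.exists_isMinimizer hab.le hgc hC (hqi a b) hqN hN0, fun u hu => ?_,
      fun u v hu hv => ?_⟩
    · exact ⟨hpos u hu, hu.solvesDirichlet hab hgc hmono (hqi a b) (hpos u hu),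
        hu.solvesDirichletClassically hab hgc hmono (hqi a b) (hpos u hu)⟩
    · exact hu.eqOn hab hgc hmono hg.strictConcave (hqi a b) hv (hpos u hu) (hpos v hv)
  · intro a b hab u v _ _ hu0 hv0 hu hv
    exact hu.eqOn hab hgc hmono hg.strictConcave (hp.continuous.intervalIntegrable a b) hv hu0 hv0
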